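/- **Setting.** Let $\omega$ be a positive measure on a measurable space $\Omega$ (for instance $\Omega\subseteq\mathbb{R}^d$), let $F:\Omega\to\Omega$ be measurable and preserve $\omega$, and let $\mathcal{K}g=g\circ F$ be the Koopman operator, an isometry of $L^2(\Omega,\omega)$ (complex-valued, norm $\|\cdot\|$). Let $\mathbb{T}\subset\mathbb{C}$ be the unit circle. Let $\mathcal{K}'$ be a unitary extension of $\mathcal{K}$ to a Hilbert space $\mathcal{H}'\supseteq L^2(\Omega,\omega)$, let $\mathcal{E}'$ be its projection-valued spectral measure on $\mathbb{T}$ (so $\mathcal{K}'=\int_{\mathbb{T}}\lambda\,d\mathcal{E}'(\lambda)$), let $\mathcal{P}:\mathcal{H}'\to L^2(\Omega,\omega)$ be the orthogonal projection, and let $\mathcal{E}=\mathcal{P}\mathcal{E}'\mathcal{P}^*$ be the spectral measure of $\mathcal{K}$. Let $\psi_1,\dots,\psi_N:\Omega\to\mathbb{C}$ be functions in $L^2(\Omega,\omega)$ and write $\Psi\boldsymbol{c}=\sum_{j=1}^N c_j\psi_j\in L^2(\Omega,\omega)$ for $\boldsymbol{c}\in\mathbb{C}^N$. Let $x^{(1)},\dots,x^{(M)}\in\Omega$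 be nodes with real weights $w_1,\dots,w_M$, and put $y^{(m)}=F(x^{(m)})$, $W=\mathrm{diag}(w_1,\dots,w_M)$, $\Psi_X=(\psi_j(x^{(m)}))_{m,j}$, $\Psi_Y=(\psi_j(y^{(m)}))_{m,j}$, $G=\Psi_X^*W\Psi_X$ and $A=\Psi_X^*W\Psi_Y$. Assume that $G$ is positive definite (for nonnegative weights: that $G$ is invertible). Let $G^{-1/2}A^*G^{-1/2}=U_1\Sigma U_2^*$ be a singular value decomposition, let $U_2U_1^*=\hat V\Lambda\hat V^*$ with $\hat V$ unitary and $\Lambda=\mathrm{diag}(\lambda_1,\dots,\lambda_N)$, let $\mathbb{K}=G^{-1/2}U_2U_1^*G^{1/2}$, and let $v_1,\dots,v_N$ be the columns of $V=G^{-1/2}\hat V$. The $\lambda_j$ lie on $\mathbb{T}$, and the discrete spectral measure of $\mathbb{K}$ is $\mathcal{E}_{N,M}=\sum_{j=1}^N v_jv_j^*G\,\delta_{\lambda_j}$. **Theorem.** There is a universal constant $C$ such that, in every such setting, for every $\phi:\mathbb{T}\to\mathbb{R}$ that is Lipschitz continuous with constant at most $1$ with respect to arc length (in particular for every $\phi$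 with $|\phi(\lambda)-\phi(\mu)|\le|\lambda-\mu|$ on $\mathbb{T}$), every integer $L\ge 2$, every $g\in L^2(\Omega,\omega)$ and every $\boldsymbol{g}\in\mathbb{C}^N$, $$ \begin{aligned} \left\|\int_{\mathbb{T}}\phi(\lambda)\,\bigl[d\mathcal{E}(\lambda)g-\Psi\,d\mathcal{E}_{N,M}(\lambda)\boldsymbol{g}\bigr]\right\| \le C\Bigl(&\frac{\log L}{L}\bigl[\|g\|+\|\Psi G^{-1/2}\|\,\|G^{1/2}\boldsymbol{g}\|_2\bigr]+\|g-\Psi\boldsymbol{g}\|\,\|\phi\|_\infty\\ &+\sum_{l=1}^{L}\frac{\|\mathcal{K}^lg-\Psi\mathbb{K}^l\boldsymbol{g}\|+\|(\mathcal{K}^*)^lg-\Psi\mathbb{K}^{-l}\boldsymbol{g}\|}{l}\Bigr), \end{aligned} $$ where $\|\Psi G^{-1/2}\|$ is the operator norm from $\mathbb{C}^N$ with the Euclidean norm $\|\cdot\|_2$ to $L^2(\Omega,\omega)$ and $\|\phi\|_\infty=\sup_{\lambda\in\mathbb{T}}|\phi(\lambda)|$. -/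

import Mathlib

open MeasureTheory Filter Topology
open scoped MatrixOrder ComplexOrder InnerProductSpace

noncomputable section

/-! ### Operator-valued measures and their integrals -/

/-- The unit circle carries its Borel sigma-algebra. -/
instance Circle.instMeasurableSpaceBorel : MeasurableSpace Circle := borel Circle

instance Circle.instBorelSpaceBorel : BorelSpace Circle := ⟨rfl⟩

/-- A normalized positive operator-valued measure on `X`, acting on the Hilbert space `H`:
every measurable set is sent to a positive bounded operator, the whole space to the identity, and
the set function is countably additive for the strong operator topology. Values at nonmeasurable
sets are irrelevant. -/
structure OperatorMeasure (X : Type*) [MeasurableSpace X] (H : Type*) [NormedAddCommGroup H]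
    [InnerProductSpace ℂ H] where
  /-- the underlying set function -/
  toFun : Set X → H →L[ℂ] H
  isPositive : ∀ S, MeasurableSet S → (toFun S).IsPositive
  map_univ : toFun Set.univ = 1
  hasSum_iUnion : ∀ S : ℕ → Set X, (∀ i, MeasurableSet (S i)) →
    Pairwise (Function.onFun Disjoint S) → ∀ x : H,
      HasSum (fun i => toFun (S i) x) (toFun (⋃ i, S i) x)

namespace OperatorMeasure

variable {X : Type*} [MeasurableSpace X] {H : Type*} [NormedAddCommGroup H]
  [InnerProductSpace ℂ H]

/-- A projection-valued measure: every measurable set is sent to an orthogonal projection. -/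
def IsProjectionValued [CompleteSpace H] (E : OperatorMeasure X H) : Prop :=
  ∀ S, MeasurableSet S → IsStarProjection (E.toFun S)

theorem map_empty_apply (E : OperatorMeasure X H) (x : H) : E.toFun ∅ x = 0 := by
  have h := E.hasSum_iUnion (fun _ => ∅) (fun _ => MeasurableSet.empty)
    (fun _ _ _ => disjoint_bot_left) x
  exact tendsto_nhds_unique tendsto_const_nhds h.summable.tendsto_atTop_zero

theorem re_inner_nonneg (E : OperatorMeasure X H) {S : Set X} (hS : MeasurableSet S) (x : H) :
    0 ≤ (⟪x, E.toFun S x⟫_ℂ).re :=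
  (E.isPositive S hS).re_inner_nonneg_right x

theorem inner_eq_re (E : OperatorMeasure X H) {S : Set X} (hS : MeasurableSet S) (x : H) :
    ⟪x, E.toFun S x⟫_ℂ = ((⟪x, E.toFun S x⟫_ℂ).re : ℂ) := by
  have h := (E.isPositive S hS).inner_nonneg_right x
  exact Complex.ext rfl (by simpa using (Complex.le_def.1 h).2.symm)

/-- The scalar measure `S ↦ ⟨E(S) x, x⟩` of a vector `x`. -/
def scalarMeasure (E : OperatorMeasure X H) (x : H) : Measure X :=
  Measure.ofMeasurable (fun S _ => ENNReal.ofReal (⟪x, E.toFun S x⟫_ℂ).re)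
    (by simp [map_empty_apply])
    (by
      intro S hS hd
      have h := Complex.hasSum_re ((E.hasSum_iUnion S hS hd x).mapL (innerSL ℂ x))
      simp only [innerSL_apply_apply] at h
      rw [← h.tsum_eq, ENNReal.ofReal_tsum_of_nonneg (fun i => E.re_inner_nonneg (hS i) x)
        h.summable])

theorem scalarMeasure_apply (E : OperatorMeasure X H) (x : H) {S : Set X} (hS : MeasurableSet S) :
    E.scalarMeasure x S = ENNReal.ofReal (⟪x, E.toFun S x⟫_ℂ).re :=
  Measure.ofMeasurable_apply S hS

theorem scalarMeasure_univ (E : OperatorMeasure X H) (x : H) :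
    E.scalarMeasure x Set.univ = ENNReal.ofReal (‖x‖ ^ 2) := by
  rw [scalarMeasure_apply E x MeasurableSet.univ, E.map_univ, one_apply_eq_self]
  exact congrArg ENNReal.ofReal (inner_self_eq_norm_sq (𝕜 := ℂ) x)

instance (E : OperatorMeasure X H) (x : H) : IsFiniteMeasure (E.scalarMeasure x) :=
  ⟨by rw [scalarMeasure_univ]; exact ENNReal.ofReal_lt_top⟩

/-- `T` is the integral `∫ φ dE`: it has the diagonal matrix elements
`⟨T x, x⟩ = ∫ φ(z) d⟨E(z) x, x⟩`, and these determine a bounded operator on a complex Hilbert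
space. -/
def HasIntegral (E : OperatorMeasure X H) (φ : X → ℂ) (T : H →L[ℂ] H) : Prop :=
  ∀ x : H, ⟪x, T x⟫_ℂ = ∫ z, φ z ∂(E.scalarMeasure x)

open Classical in
/-- The bounded operator `∫ φ dE`. It exists and is unique for every bounded measurable `φ`, see
`hasIntegral_integral` and `HasIntegral.eq_integral`. -/
def integral (E : OperatorMeasure X H) (φ : X → ℂ) : H →L[ℂ] H :=
  if h : ∃ T, E.HasIntegral φ T then h.choose else 0

theorem HasIntegral.unique {E : OperatorMeasure X H} {φ : X → ℂ} {T T' : H →L[ℂ] H}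
    (h : E.HasIntegral φ T) (h' : E.HasIntegral φ T') : T = T' := by
  have := (ext_inner_map (T : H →ₗ[ℂ] H) (T' : H →ₗ[ℂ] H)).1 (fun x => by
    have e := (h x).trans (h' x).symm
    have e2 := congrArg (starRingEnd ℂ) e
    simpa [inner_conj_symm] using e2)
  exact ContinuousLinearMap.coe_injective this

theorem HasIntegral.eq_integral {E : OperatorMeasure X H} {φ : X → ℂ} {T : H →L[ℂ] H}
    (h : E.HasIntegral φ T) : E.integral φ = T := by
  have hex : ∃ T, E.HasIntegral φ T := ⟨T, h⟩
  have : E.integral φ = hex.choose := dif_pos hex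
  rw [this]
  exact hex.choose_spec.unique h

private theorem hasIntegral_simpleFunc (E : OperatorMeasure X H) (f : SimpleFunc X ℂ) :
    ∃ T, E.HasIntegral f T := by
  refine ⟨∑ c ∈ f.range, c • E.toFun (f ⁻¹' {c}), fun x => ?_⟩
  rw [← SimpleFunc.integral_eq_integral f (SimpleFunc.integrable_of_isFiniteMeasure f),
    SimpleFunc.integral_eq, sum_apply, inner_sum]
  refine Finset.sum_congr rfl fun c _ => ?_
  rw [smul_apply, inner_smul_right, Measure.real,
    E.scalarMeasure_apply x (f.measurableSet_fiber c),
    ENNReal.toReal_ofReal (E.re_inner_nonneg (f.measurableSet_fiber c) x),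
    E.inner_eq_re (f.measurableSet_fiber c) x, Complex.real_smul, Complex.ofReal_re]
  ring

private theorem inner_polarization (T : H →L[ℂ] H) (x y : H) :
    ⟪x, T y⟫_ℂ = (⟪x + y, T (x + y)⟫_ℂ - ⟪x - y, T (x - y)⟫_ℂ
      - Complex.I * ⟪x + Complex.I • y, T (x + Complex.I • y)⟫_ℂ
      + Complex.I * ⟪x - Complex.I • y, T (x - Complex.I • y)⟫_ℂ) / 4 := by
  simp only [map_add, map_sub, map_smul, inner_add_left, inner_add_right, inner_sub_left,
    inner_sub_right, inner_smul_left, inner_smul_right, Complex.conj_I]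
  ring_nf
  simp only [Complex.I_sq]
  ring

theorem exists_hasIntegral [CompleteSpace H] (E : OperatorMeasure X H) {φ : X → ℂ}
    (hφ : Measurable φ) {R : ℝ} (hR : ∀ z, ‖φ z‖ ≤ R) : ∃ T, E.HasIntegral φ T := by
  have hφs : StronglyMeasurable φ := hφ.stronglyMeasurable
  set q : H → ℂ := fun x => ∫ z, φ z ∂(E.scalarMeasure x) with hq
  choose T hT using fun n => E.hasIntegral_simpleFunc (hφs.approxBounded R n)
  have hlim : ∀ x, Tendsto (fun n => ⟪x, T n x⟫_ℂ) atTop (𝓝 (q x)) := by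
    intro x
    simp only [hT _ x]
    by_cases hX : Nonempty X
    · have hR0 : 0 ≤ R := (norm_nonneg _).trans (hR hX.some)
      exact tendsto_integral_of_dominated_convergence (fun _ => R)
        (fun n => (SimpleFunc.stronglyMeasurable _).aestronglyMeasurable)
        (integrable_const R)
        (fun n => Eventually.of_forall fun z => hφs.norm_approxBounded_le hR0 n z)
        (Eventually.of_forall fun z => hφs.tendsto_approxBounded_of_norm_le (hR z))
    · have : IsEmpty X := not_nonempty_iff.1 hX
      simp [hq, Measure.eq_zero_of_isEmpty]
  set B : H → H → ℂ := fun x y => (q (x + y) - q (x - y) - Complex.I * q (x + Complex.I • y)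
      + Complex.I * q (x - Complex.I • y)) / 4 with hB
  have hBlim : ∀ x y, Tendsto (fun n => ⟪x, T n y⟫_ℂ) atTop (𝓝 (B x y)) := by
    intro x y
    simp only [inner_polarization (T _) x y]
    exact ((((hlim _).sub (hlim _)).sub ((hlim _).const_mul _)).add
      ((hlim _).const_mul _)).div_const 4
  have hqb : ∀ x, ‖q x‖ ≤ R * ‖x‖ ^ 2 := by
    intro x
    refine (norm_integral_le_of_norm_le_const (Eventually.of_forall hR)).trans (le_of_eq ?_)
    rw [Measure.real, scalarMeasure_univ, ENNReal.toReal_ofReal (by positivity)]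
  have hBsmul : ∀ (a b : ℂ) x y, B (a • x) (b • y) = starRingEnd ℂ a * b * B x y := by
    intro a b x y
    refine tendsto_nhds_unique (hBlim _ _) ?_
    simp only [map_smul, inner_smul_left, inner_smul_right]
    have := (hBlim x y).const_mul (starRingEnd ℂ a * b)
    refine this.congr fun n => ?_
    ring
  have hB1 : ∀ x y, ‖x‖ = 1 → ‖y‖ = 1 → ‖B x y‖ ≤ 2 * R := by
    intro x y hx hy
    have p1 := parallelogram_law_with_norm ℂ x y
    have p2 := parallelogram_law_with_norm ℂ x (Complex.I • y)
    have hIy : ‖Complex.I • y‖ = 1 := by rw [norm_smul]; simp [hy]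
    rw [hx, hy] at p1
    rw [hx, hIy] at p2
    have b1 := hqb (x + y)
    have b2 := hqb (x - y)
    have b3 := hqb (x + Complex.I • y)
    have b4 := hqb (x - Complex.I • y)
    have t : ‖B x y‖ ≤ (‖q (x + y)‖ + ‖q (x - y)‖ + ‖q (x + Complex.I • y)‖
        + ‖q (x - Complex.I • y)‖) / 4 := by
      simp only [hB, norm_div]
      have : ‖(4 : ℂ)‖ = 4 := by simp
      rw [this]
      gcongr
      refine (norm_add_le _ _).trans (add_le_add ((norm_sub_le _ _).trans
        (add_le_add (norm_sub_le _ _) ?_)) ?_) <;> simp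
    have e1 := congrArg (fun r => R * r) p1
    have e2 := congrArg (fun r => R * r) p2
    simp only [mul_add] at e1 e2
    linarith
  have hBb : ∀ x y, ‖B x y‖ ≤ 2 * R * ‖x‖ * ‖y‖ := by
    intro x y
    by_cases hx : x = 0
    · have := hBsmul 0 1 0 y
      simp only [zero_smul, one_smul, map_zero, zero_mul] at this
      simp [hx, this]
    by_cases hy : y = 0
    · have := hBsmul 1 0 x 0
      simp only [zero_smul, one_smul, mul_zero, zero_mul] at this
      simp [hy, this]
    have hx' := norm_ne_zero_iff.2 hx
    have hy' := norm_ne_zero_iff.2 hy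
    have := hB1 ((‖x‖⁻¹ : ℂ) • x) ((‖y‖⁻¹ : ℂ) • y) (by simp [norm_smul, hx'])
      (by simp [norm_smul, hy'])
    rw [hBsmul, norm_mul, norm_mul] at this
    simp only [map_inv₀, Complex.conj_ofReal, norm_inv, Complex.norm_real, norm_norm] at this
    rw [← mul_inv, inv_mul_le_iff₀ (by positivity)] at this
    linarith
  let F : H →ₗ⋆[ℂ] H →ₗ[ℂ] ℂ := LinearMap.mk₂'ₛₗ (starRingEnd ℂ) (RingHom.id ℂ) B
    (fun x x' y => tendsto_nhds_unique (hBlim _ _) (by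
      simpa only [inner_add_left] using (hBlim x y).add (hBlim x' y)))
    (fun a x y => by simpa using hBsmul a 1 x y)
    (fun x y y' => tendsto_nhds_unique (hBlim _ _) (by
      simpa only [map_add, inner_add_right] using (hBlim x y).add (hBlim x y')))
    (fun a x y => by simpa using hBsmul 1 a x y)
  let Fc : H →L⋆[ℂ] H →L[ℂ] ℂ := F.mkContinuous₂ (2 * R) hBb
  refine ⟨ContinuousLinearMap.adjoint (InnerProductSpace.continuousLinearMapOfBilin Fc), fun x => ?_⟩
  rw [ContinuousLinearMap.adjoint_inner_right,
    InnerProductSpace.continuousLinearMapOfBilin_apply]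
  exact tendsto_nhds_unique (hBlim x x) (hlim x)

theorem hasIntegral_integral [CompleteSpace H] (E : OperatorMeasure X H) {φ : X → ℂ}
    (hφ : Measurable φ) {R : ℝ} (hR : ∀ z, ‖φ z‖ ≤ R) : E.HasIntegral φ (E.integral φ) := by
  obtain ⟨T, hT⟩ := E.exists_hasIntegral hφ hR
  rwa [hT.eq_integral]

/-- The compression `S ↦ P E(S) P*` of an operator-valued measure on `H'` to a Hilbert space `H`
embedded isometrically in `H'` by `ι`; here `P = ι*` is the orthogonal projection onto `H`. -/
def compression {H' : Type*} [NormedAddCommGroup H'] [InnerProductSpace ℂ H'] [CompleteSpace H']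
    [CompleteSpace H] (E : OperatorMeasure X H') (ι : H →ₗᵢ[ℂ] H') : OperatorMeasure X H where
  toFun S := ContinuousLinearMap.adjoint ι.toContinuousLinearMap ∘L E.toFun S ∘L
    ι.toContinuousLinearMap
  isPositive S hS := (E.isPositive S hS).adjoint_conj _
  map_univ := by
    ext x
    refine ext_inner_left ℂ fun y => ?_
    simp [E.map_univ, ContinuousLinearMap.adjoint_inner_right]
  hasSum_iUnion S hS hd x :=
    (E.hasSum_iUnion S hS hd (ι x)).mapL (ContinuousLinearMap.adjoint ι.toContinuousLinearMap)

end OperatorMeasure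

/-! ### Unitary extensions and spectral measures -/

/-- `E` is the spectral measure of the unitary operator `U`: it is a projection-valued measure on
the unit circle with `U = ∫ z dE(z)`. -/
def IsSpectralMeasureOf {H : Type*} [NormedAddCommGroup H] [InnerProductSpace ℂ H]
    [CompleteSpace H] (E : OperatorMeasure Circle H) (U : H →L[ℂ] H) : Prop :=
  E.IsProjectionValued ∧ E.integral (fun z : Circle => (z : ℂ)) = U

/-- A unitary extension of a bounded operator `K` on `H`: an isometric embedding `ι` of `H` into
the Hilbert space `H'` and a unitary operator `U` on `H'` that restricts to `K` on `H`. -/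
structure UnitaryExtension {H : Type*} [NormedAddCommGroup H] [InnerProductSpace ℂ H]
    (K : H →L[ℂ] H) (H' : Type*) [NormedAddCommGroup H'] [InnerProductSpace ℂ H']
    [CompleteSpace H'] where
  ι : H →ₗᵢ[ℂ] H'
  U : H' →L[ℂ] H'
  unitary : U ∈ unitary (H' →L[ℂ] H')
  extends_op : ∀ h : H, U (ι h) = ι (K h)

/-! ### Koopman operator and measure-preserving extended dynamic mode decomposition -/

/-- The Koopman operator `g ↦ g ∘ F` on `L²(Ω, ω)`. -/
def koopman {Ω : Type*} [MeasurableSpace Ω] {ω : Measure Ω} {F : Ω → Ω}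
    (hF : MeasurePreserving F ω ω) : Lp ℂ 2 ω →L[ℂ] Lp ℂ 2 ω :=
  (Lp.compMeasurePreservingₗᵢ ℂ F hF).toContinuousLinearMap

/-- The quasimatrix `Ψ : ℂ^N → L²(Ω, ω)`, `c ↦ ∑ j, c j • ψ j`. -/
def quasimatrix {Ω : Type*} [MeasurableSpace Ω] {ω : Measure Ω} {N : ℕ} {ψ : Fin N → Ω → ℂ}
    (hψ : ∀ j, MemLp (ψ j) 2 ω) : EuclideanSpace ℂ (Fin N) →L[ℂ] Lp ℂ 2 ω :=
  ∑ j, (EuclideanSpace.proj j : EuclideanSpace ℂ (Fin N) →L[ℂ] ℂ).smulRight ((hψ j).toLp (ψ j))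

/-- The dictionary evaluated at the nodes: the matrix `(ψ j (x m))_{m, j}`. -/
def dictionaryMatrix {Ω : Type*} {N M : ℕ} (ψ : Fin N → Ω → ℂ) (x : Fin M → Ω) :
    Matrix (Fin M) (Fin N) ℂ :=
  Matrix.of fun m j => ψ j (x m)

/-- The Gram matrix `G = Ψ_X^* W Ψ_X`. -/
def gramMatrix {Ω : Type*} {N M : ℕ} (ψ : Fin N → Ω → ℂ) (x : Fin M → Ω) (w : Fin M → ℝ) :
    Matrix (Fin N) (Fin N) ℂ :=
  (dictionaryMatrix ψ x).conjTranspose * Matrix.diagonal (fun m => (w m : ℂ)) *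
    dictionaryMatrix ψ x

/-- The matrix `A = Ψ_X^* W Ψ_Y` with `y m = F (x m)`. -/
def crossMatrix {Ω : Type*} {N M : ℕ} (F : Ω → Ω) (ψ : Fin N → Ω → ℂ) (x : Fin M → Ω)
    (w : Fin M → ℝ) : Matrix (Fin N) (Fin N) ℂ :=
  (dictionaryMatrix ψ x).conjTranspose * Matrix.diagonal (fun m => (w m : ℂ)) *
    dictionaryMatrix ψ (fun m => F (x m))

/-- A run of the mpEDMD algorithm on the matrices `G` and `A`: a singular value decomposition
`G^{-1/2} A^* G^{-1/2} = U₁ Σ U₂^*` and an orthonormal eigendecomposition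
`U₂ U₁^* = Vhat Λ Vhat^*`. Neither is unique. The eigenvalues are recorded as points of the unit
circle, where the eigenvalues of the unitary matrix `U₂ U₁^*` lie. -/
structure MpEDMD {N : ℕ} (G A : Matrix (Fin N) (Fin N) ℂ) where
  U₁ : Matrix (Fin N) (Fin N) ℂ
  U₂ : Matrix (Fin N) (Fin N) ℂ
  σ : Fin N → ℝ
  Vhat : Matrix (Fin N) (Fin N) ℂ
  eigenvalue : Fin N → Circle
  U₁_mem : U₁ ∈ Matrix.unitaryGroup (Fin N) ℂ
  U₂_mem : U₂ ∈ Matrix.unitaryGroup (Fin N) ℂ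
  σ_nonneg : ∀ j, 0 ≤ σ j
  svd : (CFC.sqrt G)⁻¹ * A.conjTranspose * (CFC.sqrt G)⁻¹ =
    U₁ * Matrix.diagonal (fun j => (σ j : ℂ)) * U₂.conjTranspose
  Vhat_mem : Vhat ∈ Matrix.unitaryGroup (Fin N) ℂ
  eigendecomposition : U₂ * U₁.conjTranspose =
    Vhat * Matrix.diagonal (fun j => (eigenvalue j : ℂ)) * Vhat.conjTranspose

namespace MpEDMD

variable {N : ℕ} {G A : Matrix (Fin N) (Fin N) ℂ}

/-- The Koopman matrix `𝕂 = G^{-1/2} U₂ U₁^* G^{1/2}`. -/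
def koopmanMatrix (D : MpEDMD G A) : Matrix (Fin N) (Fin N) ℂ :=
  (CFC.sqrt G)⁻¹ * (D.U₂ * D.U₁.conjTranspose) * CFC.sqrt G

/-- The eigenvector `v j` of `𝕂`: the `j`-th column of `V = G^{-1/2} Vhat`. -/
def eigenvector (D : MpEDMD G A) (j : Fin N) : Fin N → ℂ :=
  ((CFC.sqrt G)⁻¹ * D.Vhat).col j

/-- The integral `∫ φ dE_{N,M}` against the finitely supported matrix-valued measure
`E_{N,M} = ∑ j, v_j v_j^* G δ_{λ_j}`. -/
def spectralIntegral (D : MpEDMD G A) (φ : Circle → ℂ) : Matrix (Fin N) (Fin N) ℂ :=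
  ∑ j, φ (D.eigenvalue j) •
    (Matrix.vecMulVec (D.eigenvector j) (star (D.eigenvector j)) * G)

end MpEDMD

end

noncomputable section

/-! ### A quantitative Jackson theorem on the circle -/

/-! Both spectral measures are tested against a trigonometric polynomial `q` of degree at most `L`
close to `φ`. The moments of the compressed measure are the powers of `K` and of its adjoint, and
those of the discrete measure are the integer powers of the Koopman matrix. Writing `q = ∑ d l * z ^
l`, the error splits into `(φ - q)` integrated against each measure and `∑ d l • v l`, where `v l`
is the mismatch of the `l`-th powers.

The first two pieces are small because `φ - q` is uniformly small: a positive normalized operator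
measure gives an operator of norm at most twice the sup norm (`HasIntegral.norm_le`), and the matrix
calculus is conjugate by `G^{1/2}` to that of a unitary matrix (`norm_apply_spectralIntegral_le`).
In the third piece, `|d 0| ≤ ‖φ‖_∞` and `|d l| ≤ π / (2|l|)` produce exactly the weights of the
theorem.

Such a `q` comes from `exists_trigonometric_approx`: samples of `φ` at the `2n`-th roots of unity
are averaged against the positive kernel `|P|²`, with `P` the polynomial with coefficients `k (n -
k)`. Parseval on the roots of unity and Cauchy–Schwarz give the error `O(1/n)`; summation by parts
gives the decay of `d`. This rate is better than `log L / L`, to which it is weakened at the end.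

The moment identities need multiplicativity of integration against a projection-valued measure
(`IsProjectionValued.hasIntegral_mul`), since a spectral measure is only assumed to reproduce its
unitary operator as first moment. -/

theorem Circle.mul_abs_le_norm_exp_sub_one {t : ℝ} (ht : |t| ≤ Real.pi) :
    2 / Real.pi * |t| ≤ ‖(Circle.exp t : ℂ) - 1‖ := by
  have h := Real.mul_abs_le_abs_sin (x := t / 2) (by rw [abs_div, abs_two]; linarith)
  rw [Circle.coe_exp, mul_comm (t : ℂ), Complex.norm_exp_I_mul_ofReal_sub_one, norm_mul, Real.norm_two,
    Real.norm_eq_abs]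
  rw [abs_div, abs_two] at h
  linarith

/-- The arc between two points is at most `π / 2` times the chord. Taking the angle as the principal
argument of the quotient keeps it in `[-π, π]`, where Jordan's inequality applies. -/
theorem abs_sub_le_of_lipschitzWith_exp {φ : Circle → ℝ}
    (hφ : LipschitzWith 1 (fun θ : ℝ => φ (Circle.exp θ))) (z w : Circle) :
    |φ z - φ w| ≤ Real.pi / 2 * ‖(z : ℂ) - w‖ := by
  set α := Complex.arg w
  set t := Complex.arg (z / w : Circle)
  have hw : Circle.exp α = w := Circle.exp_arg w
  have ht : Circle.exp t = z / w := Circle.exp_arg (z / w)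
  have hz : Circle.exp (α + t) = z := by rw [Circle.exp_add, hw, ht, mul_div_cancel]
  have h1 := hφ.dist_le_mul (α + t) α
  simp only [hz, hw, Real.dist_eq, add_sub_cancel_left, NNReal.coe_one, one_mul] at h1
  have h2 := Circle.mul_abs_le_norm_exp_sub_one (Complex.abs_arg_le_pi (z / w : Circle))
  have h3 : ‖(Circle.exp t : ℂ) - 1‖ = ‖(z : ℂ) - w‖ := by
    rw [ht, Circle.coe_div, ← div_self (Circle.coe_ne_zero w), ← sub_div, norm_div,
      Circle.norm_coe, div_one]
  rw [h3] at h2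
  have hpi := Real.pi_pos
  calc |φ z - φ w| ≤ |t| := h1
    _ = Real.pi / 2 * (2 / Real.pi * |t|) := by field_simp
    _ ≤ _ := by gcongr

theorem continuous_of_lipschitzWith_exp {φ : Circle → ℝ}
    (hφ : LipschitzWith 1 (fun θ : ℝ => φ (Circle.exp θ))) : Continuous φ := by
  refine (LipschitzWith.of_dist_le_mul (K := (Real.pi / 2).toNNReal) fun z w => ?_).continuous
  rw [Real.coe_toNNReal _ (by positivity), Real.dist_eq,
    show dist z w = ‖(z : ℂ) - w‖ from dist_eq_norm (z : ℂ) w]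
  exact abs_sub_le_of_lipschitzWith_exp hφ z w

/-- Parseval's identity for trigonometric polynomials sampled at roots of unity. -/
theorem sum_norm_sq_sum_mul_pow {m r : ℕ} (hr : r ≤ m) {ζ : ℂ} (hζ : IsPrimitiveRoot ζ m)
    (hζ1 : ‖ζ‖ = 1) (b : ℕ → ℂ) :
    ∑ j ∈ Finset.range m, ‖∑ k ∈ Finset.range r, b k * (ζ ^ j) ^ k‖ ^ 2 =
      m * ∑ k ∈ Finset.range r, ‖b k‖ ^ 2 := by
  have hinv : (starRingEnd ℂ) ζ = ζ⁻¹ := (Complex.inv_eq_conj hζ1).symm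
  have hζ0 : ζ ≠ 0 := by rintro rfl; simp at hζ1
  have orth : ∀ k < r, ∀ k' < r,
      ∑ j ∈ Finset.range m, (ζ ^ j) ^ k * ((ζ⁻¹) ^ j) ^ k' = if k = k' then (m : ℂ) else 0 := by
    intro k hk k' hk'
    have e : ∀ j, (ζ ^ j) ^ k * ((ζ⁻¹) ^ j) ^ k' = (ζ ^ ((k : ℤ) - k')) ^ j := by
      intro j
      rw [zpow_sub₀ hζ0, zpow_natCast, zpow_natCast, div_pow, ← pow_mul, ← pow_mul, ← pow_mul,
        ← pow_mul, inv_pow, mul_comm j k, mul_comm j k']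
      rfl
    simp only [e]
    split_ifs with h
    · simp [h]
    -- No aliasing: both exponents are below `r ≤ m`, so their nonzero difference is not a multiple
    -- of `m`.
    · have hne : ζ ^ ((k : ℤ) - k') ≠ 1 := by
        rw [Ne, hζ.zpow_eq_one_iff_dvd]
        intro hd
        have := Int.eq_zero_of_abs_lt_dvd hd (by rw [abs_lt]; omega)
        omega
      rw [geom_sum_eq hne, ← zpow_natCast, zpow_comm, zpow_natCast ζ, hζ.pow_eq_one]
      simp
  have main : ((∑ j ∈ Finset.range m, ‖∑ k ∈ Finset.range r, b k * (ζ ^ j) ^ k‖ ^ 2 : ℝ) : ℂ) =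
      ((m * ∑ k ∈ Finset.range r, ‖b k‖ ^ 2 : ℝ) : ℂ) := by
    push_cast
    simp only [← Complex.mul_conj', map_sum, map_mul, map_pow, hinv, Finset.sum_mul_sum]
    rw [Finset.sum_comm, Finset.mul_sum]
    refine Finset.sum_congr rfl fun k hk => ?_
    rw [Finset.sum_comm]
    rw [Finset.sum_eq_single_of_mem k hk]
    · have := orth k (Finset.mem_range.1 hk) k (Finset.mem_range.1 hk)
      rw [if_pos rfl] at this
      rw [← this, Finset.sum_mul]
      exact Finset.sum_congr rfl fun j _ => by ring
    · intro k' hk' hne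
      have := orth k (Finset.mem_range.1 hk) k' (Finset.mem_range.1 hk')
      rw [if_neg (Ne.symm hne)] at this
      calc _ = (b k * (starRingEnd ℂ) (b k')) *
            ∑ j ∈ Finset.range m, (ζ ^ j) ^ k * ((ζ⁻¹) ^ j) ^ k' := by
              rw [Finset.mul_sum]
              exact Finset.sum_congr rfl fun j _ => by ring
        _ = 0 := by rw [this, mul_zero]
  exact_mod_cast main

/-- This is the squared `ℓ²` norm of the kernel coefficients, the normalizing constant of the
kernel. -/
theorem sum_range_sq_mul_sub_sq (n : ℕ) :
    ∑ k ∈ Finset.range n, ((k : ℝ) * (n - k)) ^ 2 = ((n : ℝ) ^ 5 - n) / 30 := by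
  -- The parameter is decoupled from the upper limit so that induction on the limit applies.
  have key : ∀ (x : ℝ) (r : ℕ), ∑ k ∈ Finset.range r, ((k : ℝ) * (x - k)) ^ 2 =
      x ^ 2 * ((r - 1) * r * (2 * r - 1) / 6) - 2 * x * ((r - 1) ^ 2 * r ^ 2 / 4) +
        (r - 1) * r * (2 * r - 1) * (3 * (r - 1) ^ 2 + 3 * (r - 1) - 1) / 30 := by
    intro x r
    induction r with
    | zero => simp
    | succ r ih => rw [Finset.sum_range_succ, ih]; push_cast; ring
  rw [key]
  ring

/-- The sampled Fourier coefficients of a Lipschitz function decay like `1 / |l|`. -/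
theorem norm_sum_sample_mul_pow_le {φ : Circle → ℝ}
    (hφ : LipschitzWith 1 (fun θ : ℝ => φ (Circle.exp θ))) {n : ℕ} (hn : 0 < n) {l : ℤ}
    (hl : l ≠ 0) (hln : |l| ≤ n) :
    ‖∑ j ∈ Finset.range (2 * n), (φ (Circle.exp (Real.pi / n) ^ j) : ℂ) *
      ((Circle.exp (Real.pi / n) : ℂ) ^ l) ^ j‖ ≤ (2 * n : ℕ) * (Real.pi / (2 * |(l : ℝ)|)) := by
  have hn' : (0 : ℝ) < n := by exact_mod_cast hn
  have hl' : 0 < |(l : ℝ)| := by positivity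
  have hln' : |(l : ℝ)| ≤ n := by exact_mod_cast hln
  have hpi := Real.pi_pos
  set h := Real.pi / n with hh
  have hh0 : 0 < h := by positivity
  set ζ := Circle.exp h with hζ
  have hpow : ∀ j : ℕ, ζ ^ j = Circle.exp (j * h) := by
    intro j
    induction j with
    | zero => simp
    | succ j ih => rw [pow_succ, ih, hζ, ← Circle.exp_add]; congr 1; push_cast; ring
  have hper : ζ ^ (2 * n) = 1 := by
    rw [hpow, ← Circle.exp_two_pi]; congr 1; push_cast; rw [hh]; field_simp
  set χ : ℂ := (ζ : ℂ) ^ l with hχ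
  have hχ1 : ‖χ‖ = 1 := by rw [hχ, norm_zpow, Circle.norm_coe, one_zpow]
  have hχm : χ ^ (2 * n) = 1 := by
    rw [hχ, ← zpow_natCast, zpow_comm, zpow_natCast, ← Circle.coe_pow, hper]; simp
  have hχe : χ = Circle.exp (l * h) := by
    rw [hχ, hζ, ← Circle.coe_zpow, Circle.coe_exp, Circle.coe_zpow, Circle.coe_exp,
      ← Complex.exp_int_mul]
    congr 1; push_cast; ring
  -- Since `|l| ≤ n`, the phase `l * h` stays within `[-π, π]`; this is where the mesh `π / n`
  -- matters.
  have hlow : 2 / Real.pi * (|(l : ℝ)| * h) ≤ ‖χ - 1‖ := by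
    have := Circle.mul_abs_le_norm_exp_sub_one (t := l * h) (by
      rw [abs_mul, abs_of_pos hh0, hh, mul_div_assoc', div_le_iff₀ hn', mul_comm]; gcongr)
    rwa [← hχe, abs_mul, abs_of_pos hh0] at this
  set f : ℕ → ℂ := fun j => (φ (ζ ^ j) : ℂ) * χ ^ j with hf
  -- Cyclic summation by parts: by periodicity there are no boundary terms, and each increment of
  -- `φ` along the mesh is at most `h`.
  have hshift : ∑ j ∈ Finset.range (2 * n), f (j + 1) = ∑ j ∈ Finset.range (2 * n), f j := by
    have h1 := Finset.sum_range_succ f (2 * n)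
    rw [Finset.sum_range_succ'] at h1
    have h2 : f (2 * n) = f 0 := by simp [hf, hper, hχm]
    rw [h2] at h1
    exact add_right_cancel h1
  have hby : (χ - 1) * ∑ j ∈ Finset.range (2 * n), f j =
      ∑ j ∈ Finset.range (2 * n), ((φ (ζ ^ j) - φ (ζ ^ (j + 1)) : ℝ) : ℂ) * χ ^ (j + 1) := by
    rw [sub_mul, one_mul]
    nth_rewrite 2 [← hshift]
    rw [Finset.mul_sum, ← Finset.sum_sub_distrib]
    refine Finset.sum_congr rfl fun j _ => ?_
    simp only [hf]; push_cast; ring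
  have hup : ‖(χ - 1) * ∑ j ∈ Finset.range (2 * n), f j‖ ≤ (2 * n : ℕ) * h := by
    rw [hby]
    refine (norm_sum_le_of_le (n := fun _ => h) _ fun j _ => ?_).trans (by simp)
    rw [norm_mul, norm_pow, hχ1, one_pow, mul_one, Complex.norm_real, Real.norm_eq_abs,
      hpow, hpow]
    have := hφ.dist_le_mul (j * h) ((j + 1 : ℕ) * h)
    rw [Real.dist_eq, Real.dist_eq] at this
    refine this.trans (le_of_eq ?_)
    rw [NNReal.coe_one, one_mul, ← sub_mul, abs_mul, abs_of_pos hh0]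
    push_cast
    simp
  rw [norm_mul] at hup
  set T := ‖∑ j ∈ Finset.range (2 * n), f j‖
  have h1 : 2 / Real.pi * (|(l : ℝ)| * h) * T ≤ (2 * n : ℕ) * h :=
    (mul_le_mul_of_nonneg_right hlow (norm_nonneg _)).trans hup
  rw [mul_div_assoc', le_div_iff₀ (by positivity)]
  have h2 : 2 / Real.pi * (|(l : ℝ)| * h) * T = (T * (2 * |(l : ℝ)|)) * (h / Real.pi) := by ring
  have h3 : ((2 * n : ℕ) : ℝ) * h = ((2 * n : ℕ) * Real.pi) * (h / Real.pi) := by field_simp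
  rw [h2, h3] at h1
  exact le_of_mul_le_mul_right h1 (by positivity)

/-- The autocorrelation of a nonnegative sequence is at most its value at zero. -/
theorem sum_fiber_mul_le {a : ℕ → ℝ} (n : ℕ) (l : ℤ) :
    ∑ p ∈ Finset.range n ×ˢ Finset.range n with (p.1 : ℤ) - p.2 = l, a p.1 * a p.2 ≤
      ∑ k ∈ Finset.range n, a k ^ 2 := by
  set s := (Finset.range n ×ˢ Finset.range n).filter fun p => (p.1 : ℤ) - p.2 = l with hs
  have hmem : ∀ p ∈ s, p.1 ∈ Finset.range n ∧ p.2 ∈ Finset.range n ∧ (p.1 : ℤ) - p.2 = l := by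
    intro p hp
    simp only [hs, Finset.mem_filter, Finset.mem_product] at hp
    exact ⟨hp.1.1, hp.1.2, hp.2⟩
  -- On the line `p.1 - p.2 = l` each coordinate determines the other, so both projections are
  -- injective; the inequality `xy ≤ (x² + y²) / 2` then finishes.
  have h1 : ∑ p ∈ s, a p.1 ^ 2 ≤ ∑ k ∈ Finset.range n, a k ^ 2 := by
    rw [← Finset.sum_image (s := s) (f := fun k => a k ^ 2) (g := Prod.fst)]
    · refine Finset.sum_le_sum_of_subset_of_nonneg ?_ fun _ _ _ => sq_nonneg _
      exact Finset.image_subset_iff.2 fun p hp => (hmem p hp).1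
    · intro p hp q hq e
      have := (hmem p hp).2.2; have := (hmem q hq).2.2
      exact Prod.ext e (by omega)
  have h2 : ∑ p ∈ s, a p.2 ^ 2 ≤ ∑ k ∈ Finset.range n, a k ^ 2 := by
    rw [← Finset.sum_image (s := s) (f := fun k => a k ^ 2) (g := Prod.snd)]
    · refine Finset.sum_le_sum_of_subset_of_nonneg ?_ fun _ _ _ => sq_nonneg _
      exact Finset.image_subset_iff.2 fun p hp => (hmem p hp).2.1
    · intro p hp q hq e
      have := (hmem p hp).2.2; have := (hmem q hq).2.2
      exact Prod.ext (by omega) e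
  have h3 : ∑ p ∈ s, a p.1 * a p.2 ≤ ∑ p ∈ s, (a p.1 ^ 2 + a p.2 ^ 2) / 2 :=
    Finset.sum_le_sum fun p _ => by nlinarith [sq_nonneg (a p.1 - a p.2)]
  rw [← Finset.sum_div, Finset.sum_add_distrib] at h3
  linarith

/-- **Jackson's theorem** on the circle, by discrete convolution with a positive kernel, together
with the decay of the coefficients of the approximating trigonometric polynomial. -/
theorem exists_trigonometric_approx {φ : Circle → ℝ}
    (hφ : LipschitzWith 1 (fun θ : ℝ => φ (Circle.exp θ))) {n : ℕ} (hn : 2 ≤ n) :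
    ∃ d : ℤ → ℂ,
      (∀ z : Circle, ‖(φ z : ℂ) -
        ∑ l ∈ Finset.Icc (-((n : ℤ) - 1)) (n - 1), d l * (z : ℂ) ^ l‖ ≤ 4 * Real.pi / n) ∧
      (∀ R, (∀ z, |φ z| ≤ R) → ‖d 0‖ ≤ R) ∧
      ∀ l : ℤ, l ≠ 0 → |l| ≤ n → ‖d l‖ ≤ Real.pi / (2 * |(l : ℝ)|) := by
  have hn0 : 0 < n := by omega
  have hnR : (2 : ℝ) ≤ n := by exact_mod_cast hn
  have hpi := Real.pi_pos
  -- Parseval for degree below `n` would need only `n` nodes; doubling them gives the mesh `π / n`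
  -- required by the coefficient decay.
  set m : ℕ := 2 * n with hm
  have hm0 : (0 : ℝ) < (m : ℕ) := by rw [hm]; push_cast; linarith
  set ζ := Circle.exp (Real.pi / n) with hζ
  have hζp : IsPrimitiveRoot (ζ : ℂ) m := by
    have := Complex.isPrimitiveRoot_exp m (by omega)
    convert this using 1
    rw [hζ, Circle.coe_exp, hm]
    congr 1
    have : (n : ℂ) ≠ 0 := by exact_mod_cast hn0.ne'
    push_cast
    field_simp
  -- A discrete parabola vanishing at `0` and `n`: multiplying `P` by `u - 1` differences it with no
  -- boundary terms. Its squares sum to order `n ^ 5`, those of its differences to at most `n ^ 3`.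
  set a : ℕ → ℝ := fun k => k * (n - k) with ha
  set S : ℝ := ∑ k ∈ Finset.range n, a k ^ 2 with hS
  have hSeq : S = ((n : ℝ) ^ 5 - n) / 30 := sum_range_sq_mul_sub_sq n
  have hSlow : (n : ℝ) ^ 5 / 60 ≤ S := by
    rw [hSeq]
    have : (2 : ℝ) ^ 4 ≤ (n : ℝ) ^ 4 := by gcongr
    nlinarith
  have hS0 : 0 < S := lt_of_lt_of_le (by positivity) hSlow
  -- These are the Fourier coefficients of `|P|²`; the bounds `0 ≤ κ l ≤ S` make the normalized
  -- multiplier at most one, so `d` inherits the bounds of the sampled coefficients of `φ`.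
  set κ : ℤ → ℝ := fun l =>
    ∑ p ∈ Finset.range n ×ˢ Finset.range n with (p.1 : ℤ) - p.2 = l, a p.1 * a p.2 with hκ
  have hκS : ∀ l, κ l ≤ S := fun l => sum_fiber_mul_le n l
  have hκ0 : ∀ l, 0 ≤ κ l := by
    intro l
    refine Finset.sum_nonneg fun p hp => ?_
    simp only [Finset.mem_filter, Finset.mem_product, Finset.mem_range] at hp
    have h1 : (p.1 : ℝ) ≤ n := by exact_mod_cast hp.1.1.le
    have h2 : (p.2 : ℝ) ≤ n := by exact_mod_cast hp.1.2.le
    exact mul_nonneg (mul_nonneg (by positivity) (by linarith))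
      (mul_nonneg (by positivity) (by linarith))
  set d : ℤ → ℂ := fun l => (κ l / (m * S) : ℝ) *
    ∑ j ∈ Finset.range m, (φ (ζ ^ j) : ℂ) * ((ζ : ℂ) ^ (-l)) ^ j with hd
  have hdle : ∀ l B, ‖∑ j ∈ Finset.range m, (φ (ζ ^ j) : ℂ) * ((ζ : ℂ) ^ (-l)) ^ j‖ ≤ m * B →
      ‖d l‖ ≤ B := by
    intro l B hB
    rw [hd, norm_mul, Complex.norm_real, Real.norm_of_nonneg (div_nonneg (hκ0 l) (by positivity))]
    calc κ l / (m * S) * _ ≤ S / (m * S) * (m * B) := by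
          gcongr
          exact hκS l
      _ = B := by field_simp
  refine ⟨d, fun z => ?_, fun R hR => ?_, fun l hl hln => ?_⟩
  · set u : ℕ → ℂ := fun j => (z : ℂ)⁻¹ * (ζ : ℂ) ^ j with hu
    have hz0 := Circle.coe_ne_zero z
    have hζ0 := Circle.coe_ne_zero ζ
    have hu1 : ∀ j, ‖u j‖ = 1 := fun j => by
      rw [hu, norm_mul, norm_inv, norm_pow, Circle.norm_coe, Circle.norm_coe, one_pow, inv_one, mul_one]
    set P : ℕ → ℂ := fun j => ∑ k ∈ Finset.range n, (a k : ℂ) * u j ^ k with hP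
    have parseval : ∀ b : ℕ → ℝ, ∑ j ∈ Finset.range m,
        ‖∑ k ∈ Finset.range n, (b k : ℂ) * u j ^ k‖ ^ 2 = m * ∑ k ∈ Finset.range n, b k ^ 2 := by
      intro b
      have := sum_norm_sq_sum_mul_pow (r := n) (by omega) hζp (Circle.norm_coe ζ)
        (fun k => (b k : ℂ) * (z : ℂ)⁻¹ ^ k)
      simp only [norm_mul, norm_pow, norm_inv, Circle.norm_coe, inv_one, one_pow, mul_one,
        Complex.norm_real, Real.norm_eq_abs, sq_abs] at this
      rw [← this]
      simp only [hu, mul_pow, mul_assoc]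
    have hPsum : ∑ j ∈ Finset.range m, ‖P j‖ ^ 2 = m * S := parseval a
    have hPu : ∀ j, ‖P j‖ * ‖1 - u j‖ =
        ‖∑ k ∈ Finset.range n, ((a k - a (k + 1) : ℝ) : ℂ) * u j ^ k‖ := by
      intro j
      have h1 : P j * (u j - 1) =
          u j * ∑ k ∈ Finset.range n, ((a k - a (k + 1) : ℝ) : ℂ) * u j ^ k := by
        have h2 := Finset.sum_range_succ (fun k => (a k : ℂ) * u j ^ k) n
        rw [Finset.sum_range_succ'] at h2
        have h3 : a n = 0 := by simp [ha]
        have h4 : a 0 = 0 := by simp [ha]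
        simp only [h3, h4, Complex.ofReal_zero, zero_mul, add_zero] at h2
        rw [mul_sub, mul_one]
        nth_rewrite 2 [hP]
        simp only
        rw [← h2, hP, Finset.sum_mul, Finset.mul_sum, ← Finset.sum_sub_distrib]
        refine Finset.sum_congr rfl fun k _ => ?_
        push_cast; ring
      rw [norm_sub_rev, ← norm_mul, h1, norm_mul, hu1, one_mul]
    have hdiff : ∑ j ∈ Finset.range m, (‖P j‖ * ‖1 - u j‖) ^ 2 ≤ m * (n : ℝ) ^ 3 := by
      simp only [hPu]
      rw [parseval fun k => a k - a (k + 1)]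
      gcongr
      calc ∑ k ∈ Finset.range n, (a k - a (k + 1)) ^ 2 ≤ ∑ k ∈ Finset.range n, (n : ℝ) ^ 2 := by
            refine Finset.sum_le_sum fun k hk => sq_le_sq' ?_ ?_ <;>
            · have : (k : ℝ) + 1 ≤ n := by exact_mod_cast Finset.mem_range.1 hk
              have : (0 : ℝ) ≤ k := by positivity
              simp only [ha]; push_cast; nlinarith
        _ = (n : ℝ) ^ 3 := by simp; ring
    -- Expanding `|P|²` and grouping by frequency identifies the polynomial with a weighted average
    -- of the samples; the weights are nonnegative and sum to one by `hPsum`.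
    have hq : ∑ l ∈ Finset.Icc (-((n : ℤ) - 1)) (n - 1), d l * (z : ℂ) ^ l =
        ((∑ j ∈ Finset.range m, φ (ζ ^ j) * ‖P j‖ ^ 2 / (m * S) : ℝ) : ℂ) := by
      have hPP : ∀ j, ((‖P j‖ : ℂ)) ^ 2 = ∑ l ∈ Finset.Icc (-((n : ℤ) - 1)) (n - 1),
          (κ l : ℂ) * ((z : ℂ) ^ l * ((ζ : ℂ) ^ (-l)) ^ j) := by
        intro j
        have hconj : (starRingEnd ℂ) (u j) = (u j)⁻¹ := (Complex.inv_eq_conj (hu1 j)).symm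
        have huj : u j ≠ 0 := fun h => by simpa [h] using hu1 j
        rw [← Complex.conj_mul', hP]
        simp only [map_sum, map_mul, map_pow, Complex.conj_ofReal, hconj]
        rw [Finset.sum_mul_sum, ← Finset.sum_product', ← Finset.sum_fiberwise_of_maps_to
          (g := fun p : ℕ × ℕ => (p.1 : ℤ) - p.2)
          (t := Finset.Icc (-((n : ℤ) - 1)) (n - 1))]
        · refine Finset.sum_congr rfl fun l _ => ?_
          simp only [hκ]
          push_cast
          rw [Finset.sum_mul]
          refine Finset.sum_congr rfl fun p hp => ?_
          have hpl := (Finset.mem_filter.1 hp).2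
          have e1 : (z : ℂ) ^ l * ((ζ : ℂ) ^ (-l)) ^ j = (u j) ^ (-l) := by
            rw [hu, mul_zpow, inv_zpow, ← zpow_neg, neg_neg, ← zpow_natCast, ← zpow_natCast,
              zpow_comm]
          have e2 : (u j) ^ (-l) = (u j)⁻¹ ^ p.1 * u j ^ p.2 := by
            rw [← hpl, neg_sub, zpow_sub₀ huj, zpow_natCast, zpow_natCast, inv_pow]
            field_simp
          rw [e1, e2]; ring
        · intro p hp
          simp only [Finset.mem_product, Finset.mem_range] at hp
          rw [Finset.mem_Icc]
          omega
      push_cast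
      simp only [hPP, hd, Finset.mul_sum, Finset.sum_mul, Finset.sum_div]
      rw [Finset.sum_comm]
      refine Finset.sum_congr rfl fun j _ => Finset.sum_congr rfl fun l _ => ?_
      push_cast; ring
    have h1 : φ z = ∑ j ∈ Finset.range m, φ z * ‖P j‖ ^ 2 / (m * S) := by
      rw [← Finset.sum_div, ← Finset.mul_sum, hPsum]; field_simp
    rw [hq, ← Complex.ofReal_sub, Complex.norm_real, Real.norm_eq_abs, h1,
      ← Finset.sum_sub_distrib]
    -- Cauchy–Schwarz bounds the first moment of the kernel by its mass and second moment. The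
    -- constant `8` comes from `60 ≤ 8²`, with `60` from `hSlow`.
    have hsum : ∑ j ∈ Finset.range m, ‖P j‖ * (‖P j‖ * ‖1 - u j‖) ≤ m * S * (8 / n) := by
      have hcs := Finset.sum_mul_sq_le_sq_mul_sq (Finset.range m) (fun j => ‖P j‖)
        (fun j => ‖P j‖ * ‖1 - u j‖)
      rw [hPsum] at hcs
      refine le_of_sq_le_sq ?_ (by positivity)
      refine hcs.trans ?_
      calc m * S * ∑ j ∈ Finset.range m, (‖P j‖ * ‖1 - u j‖) ^ 2
          ≤ m * S * (m * (n : ℝ) ^ 3) := by gcongr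
        _ = (m : ℝ) ^ 2 * S * (n : ℝ) ^ 5 / 60 * (60 / n ^ 2) := by field_simp
        _ ≤ (m : ℝ) ^ 2 * S * S * (64 / n ^ 2) := by
            rw [mul_div_assoc]; gcongr; norm_num
        _ = _ := by ring
    calc _ ≤ ∑ j ∈ Finset.range m,
          Real.pi / 2 / (m * S) * (‖P j‖ * (‖P j‖ * ‖1 - u j‖)) := by
          refine (Finset.abs_sum_le_sum_abs _ _).trans (Finset.sum_le_sum fun j _ => ?_)
          have h2 := abs_sub_le_of_lipschitzWith_exp hφ z (ζ ^ j)
          have h3 : ‖(z : ℂ) - (ζ ^ j : Circle)‖ = ‖1 - u j‖ := by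
            have : (z : ℂ) - (ζ ^ j : Circle) = z * (1 - u j) := by
              simp only [hu, Circle.coe_pow]; field_simp
            rw [this, norm_mul, Circle.norm_coe, one_mul]
          rw [h3] at h2
          rw [← sub_div, ← sub_mul, abs_div, abs_mul, abs_of_pos (show 0 < m * S by positivity),
            abs_of_nonneg (sq_nonneg ‖P j‖)]
          calc _ ≤ Real.pi / 2 * ‖1 - u j‖ * ‖P j‖ ^ 2 / (m * S) := by gcongr
            _ = _ := by ring
      _ ≤ Real.pi / 2 / (m * S) * (m * S * (8 / n)) := by
          rw [← Finset.mul_sum]; gcongr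
      _ = 4 * Real.pi / n := by field_simp; norm_num
  · refine hdle 0 R ?_
    refine (norm_sum_le_of_le (n := fun _ => R) _ fun j _ => ?_).trans (by simp)
    simpa using hR (ζ ^ j)
  · refine hdle l _ ?_
    have := norm_sum_sample_mul_pow_le hφ hn0 (neg_ne_zero.2 hl) (by rwa [abs_neg])
    simpa only [Int.cast_neg, abs_neg] using this

/-! ### Calculus of integrals against operator-valued measures -/

namespace OperatorMeasure

variable {X : Type*} [MeasurableSpace X] {H : Type*} [NormedAddCommGroup H]
  [InnerProductSpace ℂ H] {E : OperatorMeasure X H} {φ χ : X → ℂ} {T T' : H →L[ℂ] H}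

theorem HasIntegral.add (h : E.HasIntegral φ T) (h' : E.HasIntegral χ T')
    (hφ : ∀ x, Integrable φ (E.scalarMeasure x)) (hχ : ∀ x, Integrable χ (E.scalarMeasure x)) :
    E.HasIntegral (fun z => φ z + χ z) (T + T') := fun x => by
  rw [add_apply, inner_add_right, h x, h' x, integral_add (hφ x) (hχ x)]

theorem HasIntegral.const_smul (c : ℂ) (h : E.HasIntegral φ T) :
    E.HasIntegral (fun z => c * φ z) (c • T) := fun x => by
  rw [smul_apply, inner_smul_right, h x, integral_const_mul]

theorem hasIntegral_zero : E.HasIntegral (fun _ => 0) 0 := fun x => by simp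

theorem HasIntegral.sum {ι : Type*} (s : Finset ι) {φ : ι → X → ℂ} {T : ι → H →L[ℂ] H}
    (h : ∀ i ∈ s, E.HasIntegral (φ i) (T i))
    (hφ : ∀ i ∈ s, ∀ x, Integrable (φ i) (E.scalarMeasure x)) :
    E.HasIntegral (fun z => ∑ i ∈ s, φ i z) (∑ i ∈ s, T i) := fun x => by
  rw [sum_apply, inner_sum, integral_finsetSum _ fun i hi => hφ i hi x]
  exact Finset.sum_congr rfl fun i hi => h i hi x

theorem HasIntegral.sub (h : E.HasIntegral φ T) (h' : E.HasIntegral χ T')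
    (hφ : ∀ x, Integrable φ (E.scalarMeasure x)) (hχ : ∀ x, Integrable χ (E.scalarMeasure x)) :
    E.HasIntegral (fun z => φ z - χ z) (T - T') := fun x => by
  rw [sub_apply, inner_sub_right, h x, h' x, integral_sub (hφ x) (hχ x)]

theorem hasIntegral_one : E.HasIntegral (fun _ => 1) 1 := fun x => by
  rw [integral_const, Measure.real, scalarMeasure_univ, ENNReal.toReal_ofReal (by positivity),
    one_apply_eq_self, inner_self_eq_norm_sq_to_K]
  simp

theorem hasIntegral_indicator {S : Set X} (hS : MeasurableSet S) :
    E.HasIntegral (S.indicator fun _ => 1) (E.toFun S) := fun x => by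
  rw [integral_indicator hS, setIntegral_const, Measure.real, E.scalarMeasure_apply x hS,
    ENNReal.toReal_ofReal (E.re_inner_nonneg hS x), Complex.real_smul, mul_one,
    ← E.inner_eq_re hS x]

theorem HasIntegral.adjoint [CompleteSpace H] (h : E.HasIntegral φ T) :
    E.HasIntegral (fun z => starRingEnd ℂ (φ z)) (ContinuousLinearMap.adjoint T) := fun x => by
  rw [ContinuousLinearMap.adjoint_inner_right, ← inner_conj_symm, h x, integral_conj]

theorem integrable_of_norm_le (hφ : Measurable φ) {R : ℝ} (hR : ∀ z, ‖φ z‖ ≤ R) (x : H) :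
    Integrable φ (E.scalarMeasure x) :=
  Integrable.of_bound hφ.aestronglyMeasurable R (Eventually.of_forall hR)

/-- The integral of a function bounded by `ε` has numerical radius at most `ε`, hence norm at most
`2 * ε`. -/
theorem HasIntegral.norm_le (h : E.HasIntegral φ T) {ε : ℝ} (hε : 0 ≤ ε)
    (hφ : ∀ z, ‖φ z‖ ≤ ε) : ‖T‖ ≤ 2 * ε := by
  have hq : ∀ x, ‖⟪T x, x⟫_ℂ‖ ≤ ε * (‖x‖ * ‖x‖) := by
    intro x
    rw [norm_inner_symm, h x]
    refine (norm_integral_le_of_norm_le_const (Eventually.of_forall hφ)).trans (le_of_eq ?_)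
    rw [Measure.real, scalarMeasure_univ, ENNReal.toReal_ofReal (by positivity), sq]
  -- Polarization passes from the diagonal to all matrix elements, and the parallelogram law sums
  -- the four squared norms.
  have hB : ∀ x y, ‖⟪T y, x⟫_ℂ‖ ≤ ε * (‖x‖ * ‖x‖ + ‖y‖ * ‖y‖) := by
    intro x y
    have p1 := congrArg (ε * ·) (parallelogram_law_with_norm ℂ x y)
    have p2 := congrArg (ε * ·) (parallelogram_law_with_norm ℂ x (Complex.I • y))
    have hIy : ‖Complex.I • y‖ = ‖y‖ := by simp [norm_smul]
    rw [hIy] at p2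
    simp only [mul_add] at p1 p2
    have b1 := hq (x + y)
    have b2 := hq (x - y)
    have b3 := hq (x + Complex.I • y)
    have b4 := hq (x - Complex.I • y)
    have e := inner_map_polarization (T : H →ₗ[ℂ] H) x y
    simp only [ContinuousLinearMap.coe_coe] at e
    have t : ‖⟪T y, x⟫_ℂ‖ ≤ (‖⟪T (x + y), x + y⟫_ℂ‖ + ‖⟪T (x - y), x - y⟫_ℂ‖
        + ‖⟪T (x + Complex.I • y), x + Complex.I • y⟫_ℂ‖
        + ‖⟪T (x - Complex.I • y), x - Complex.I • y⟫_ℂ‖) / 4 := by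
      rw [e, norm_div, show ‖(4 : ℂ)‖ = 4 by simp]
      gcongr
      refine (norm_sub_le _ _).trans (add_le_add ((norm_add_le _ _).trans
        (add_le_add (norm_sub_le _ _) ?_)) ?_) <;>
      rw [norm_mul, Complex.norm_I, one_mul]
    linarith
  refine T.opNorm_le_bound (by positivity) fun x => ?_
  by_cases hT : T x = 0
  · rw [hT, norm_zero]; positivity
  have hT' : 0 < ‖T x‖ := norm_pos_iff.2 hT
  by_cases hx : x = 0
  · simp [hx] at hT
  have hx' : 0 < ‖x‖ := norm_pos_iff.2 hx
  -- Rescaling `T x` to the length of `x` balances the two squares, which is where the factor `2`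
  -- arises.
  have h1 := hB (((‖x‖ / ‖T x‖ : ℝ) : ℂ) • T x) x
  have h2 : ‖((‖x‖ / ‖T x‖ : ℝ) : ℂ) • T x‖ = ‖x‖ := by
    rw [norm_smul, Complex.norm_real, Real.norm_of_nonneg (by positivity)]
    field_simp
  rw [h2, inner_smul_right, inner_self_eq_norm_sq_to_K, norm_mul, Complex.norm_real,
    Real.norm_of_nonneg (by positivity)] at h1
  simp only [Complex.coe_algebraMap, norm_pow, Complex.norm_real, norm_norm] at h1
  have h3 : ‖x‖ / ‖T x‖ * ‖T x‖ ^ 2 = ‖x‖ * ‖T x‖ := by field_simp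
  rw [h3] at h1
  refine le_of_mul_le_mul_left ?_ hx'
  linarith

section Compression

variable {H' : Type*} [NormedAddCommGroup H'] [InnerProductSpace ℂ H'] [CompleteSpace H']
  [CompleteSpace H]

theorem scalarMeasure_compression (E : OperatorMeasure X H') (ι : H →ₗᵢ[ℂ] H') (x : H) :
    (E.compression ι).scalarMeasure x = E.scalarMeasure (ι x) := by
  ext S hS
  rw [scalarMeasure_apply _ _ hS, scalarMeasure_apply _ _ hS]
  simp [compression, ContinuousLinearMap.adjoint_inner_right]

theorem HasIntegral.compression {E : OperatorMeasure X H'} {T : H' →L[ℂ] H'}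
    (h : E.HasIntegral φ T) (ι : H →ₗᵢ[ℂ] H') :
    (E.compression ι).HasIntegral φ (ContinuousLinearMap.adjoint ι.toContinuousLinearMap ∘L T ∘L
      ι.toContinuousLinearMap) := fun x => by
  rw [scalarMeasure_compression, ← h (ι x)]
  simp [ContinuousLinearMap.adjoint_inner_right]

end Compression

/-! ### Multiplicativity for projection-valued measures -/

section ProjectionValued

variable [CompleteSpace H]

omit [CompleteSpace H] in
theorem toFun_union {S S' : Set X} (hS : MeasurableSet S) (hS' : MeasurableSet S')
    (hd : Disjoint S S') : E.toFun (S ∪ S') = E.toFun S + E.toFun S' := by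
  refine (hasIntegral_indicator (hS.union hS')).unique ?_
  rw [Set.indicator_union_of_disjoint hd]
  exact (hasIntegral_indicator hS).add (hasIntegral_indicator hS')
    (fun x => (integrable_const _).indicator hS) (fun x => (integrable_const _).indicator hS')

/-- For projections `P` and `Q` whose sum is again idempotent, `PQ + QP = 0`. Multiplying by `P` on
either side shows that they commute, whence `2PQ = 0`. -/
theorem IsProjectionValued.mul_eq_zero (hE : E.IsProjectionValued) {S S' : Set X}
    (hS : MeasurableSet S) (hS' : MeasurableSet S') (hd : Disjoint S S') :
    E.toFun S * E.toFun S' = 0 := by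
  have hP := (hE S hS).isIdempotentElem.eq
  have hQ := (hE S' hS').isIdempotentElem.eq
  have hPQ := (hE _ (hS.union hS')).isIdempotentElem.eq
  rw [toFun_union hS hS' hd] at hPQ
  set P := E.toFun S
  set Q := E.toFun S'
  have h0 : P * Q + Q * P = 0 := by
    have : (P + Q) * (P + Q) = P * P + Q * Q + (P * Q + Q * P) := by noncomm_ring
    rw [this, hP, hQ] at hPQ
    simpa using hPQ
  have h1 : P * Q + P * Q * P = 0 := by
    have := congrArg (P * ·) h0
    simpa only [mul_add, ← mul_assoc, hP, mul_zero] using this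
  have h2 : P * Q * P + Q * P = 0 := by
    have := congrArg (· * P) h0
    simpa only [add_mul, mul_assoc, hP, zero_mul] using this
  have h3 : P * Q = Q * P := by
    have : P * Q - Q * P = (P * Q + P * Q * P) - (P * Q * P + Q * P) := by abel
    rwa [h1, h2, sub_zero, sub_eq_zero] at this
  rw [← h3, ← two_smul ℂ] at h0
  exact (smul_eq_zero.1 h0).resolve_left two_ne_zero

omit [CompleteSpace H] in
theorem toFun_compl_add {S : Set X} (hS : MeasurableSet S) : E.toFun S + E.toFun Sᶜ = 1 := by
  rw [← toFun_union hS hS.compl disjoint_compl_right, Set.union_compl_self, E.map_univ]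

theorem IsProjectionValued.mul_toFun (hE : E.IsProjectionValued) {S S' : Set X}
    (hS : MeasurableSet S) (hS' : MeasurableSet S') :
    E.toFun S' * E.toFun S = E.toFun (S' ∩ S) := by
  have h1 : E.toFun S' = E.toFun (S' ∩ S) + E.toFun (S' \ S) := by
    rw [← toFun_union (hS'.inter hS) (hS'.diff hS)
      (Set.disjoint_sdiff_right.mono_left Set.inter_subset_right), Set.inter_union_sdiff]
  have h2 : E.toFun (S' ∩ S) * E.toFun S = E.toFun (S' ∩ S) := by
    have := congrArg (E.toFun (S' ∩ S) * ·) (toFun_compl_add (E := E) hS)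
    simpa only [mul_add, mul_one, hE.mul_eq_zero (hS'.inter hS) hS.compl
      (disjoint_compl_right.mono_left Set.inter_subset_right), add_zero] using this
  rw [h1, add_mul, h2, hE.mul_eq_zero (hS'.diff hS) hS Set.disjoint_sdiff_left, add_zero]

theorem IsProjectionValued.scalarMeasure_toFun (hE : E.IsProjectionValued) {S : Set X}
    (hS : MeasurableSet S) (x : H) :
    E.scalarMeasure (E.toFun S x) = (E.scalarMeasure x).restrict S := by
  ext S' hS'
  rw [Measure.restrict_apply hS', scalarMeasure_apply _ _ hS',
    scalarMeasure_apply _ _ (hS'.inter hS)]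
  congr 2
  have h1 : E.toFun S' (E.toFun S x) = E.toFun (S' ∩ S) x :=
    congrArg (· x) (hE.mul_toFun hS hS')
  have h2 : E.toFun S (E.toFun (S' ∩ S) x) = E.toFun (S' ∩ S) x := by
    have := congrArg (· x) (hE.mul_toFun (hS'.inter hS) hS)
    rwa [show S ∩ (S' ∩ S) = S' ∩ S from
      Set.inter_eq_right.2 Set.inter_subset_right] at this
  have h3 := (hE S hS).isSelfAdjoint.adjoint_eq
  rw [h1, ← ContinuousLinearMap.adjoint_inner_right, h3, h2]

theorem IsProjectionValued.hasIntegral_mul_indicator_conj (hE : E.IsProjectionValued)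
    (h : E.HasIntegral φ T) {S : Set X} (hS : MeasurableSet S) :
    E.HasIntegral (fun z => φ z * S.indicator (fun _ => 1) z)
      (E.toFun S * T * E.toFun S) := fun x => by
  have e : (fun z => φ z * S.indicator (fun _ => 1) z) = S.indicator φ := by
    ext z; by_cases hz : z ∈ S <;> simp [hz]
  rw [e, integral_indicator hS, ← hE.scalarMeasure_toFun hS, ← h]
  have h3 := (hE S hS).isSelfAdjoint.adjoint_eq
  nth_rewrite 3 [← h3]
  rw [ContinuousLinearMap.adjoint_inner_left]
  rfl

/-- Splitting `φ` over `S` and its complement and using uniqueness shows that `T` is block diagonal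
for `E.toFun S`, so compressing by this projection on both sides is the same as multiplying on the
right. -/
theorem IsProjectionValued.hasIntegral_mul_indicator (hE : E.IsProjectionValued)
    (h : E.HasIntegral φ T) (hφ : ∀ x, Integrable φ (E.scalarMeasure x)) {S : Set X}
    (hS : MeasurableSet S) :
    E.HasIntegral (fun z => φ z * S.indicator (fun _ => 1) z) (T * E.toFun S) := by
  have hi : ∀ {S : Set X}, MeasurableSet S → ∀ x,
      Integrable (fun z => φ z * S.indicator (fun _ => 1) z) (E.scalarMeasure x) := by
    intro S hS x
    have e : (fun z => φ z * S.indicator (fun _ => 1) z) = S.indicator φ := by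
      ext z; by_cases hz : z ∈ S <;> simp [hz]
    rw [e]
    exact (hφ x).indicator hS
  have h1 := (hE.hasIntegral_mul_indicator_conj h hS).add
    (hE.hasIntegral_mul_indicator_conj h hS.compl) (hi hS) (hi hS.compl)
  have e : (fun z => φ z * S.indicator (fun _ => 1) z + φ z * Sᶜ.indicator (fun _ => 1) z) = φ := by
    ext z; by_cases hz : z ∈ S <;> simp [hz]
  rw [e] at h1
  have h2 := h.unique h1
  have h3 : T * E.toFun S = E.toFun S * T * E.toFun S := by
    conv_lhs => rw [h2]
    rw [add_mul, mul_assoc _ (E.toFun Sᶜ), hE.mul_eq_zero hS.compl hS disjoint_compl_left,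
      mul_zero, add_zero, mul_assoc, (hE S hS).isIdempotentElem.eq]
  rw [h3]
  exact hE.hasIntegral_mul_indicator_conj h hS

theorem IsProjectionValued.exists_hasIntegral_mul_simpleFunc (hE : E.IsProjectionValued)
    (h : E.HasIntegral φ T) (hφm : Measurable φ) {R : ℝ} (hR : ∀ z, ‖φ z‖ ≤ R)
    (f : SimpleFunc X ℂ) :
    ∃ A, E.HasIntegral f A ∧ E.HasIntegral (fun z => φ z * f z) (T * A) := by
  have hφ := integrable_of_norm_le (E := E) hφm hR
  induction f using SimpleFunc.induction with
  | const c hS =>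
    rename_i S
    have e : ⇑((SimpleFunc.const X c).piecewise S hS (SimpleFunc.const X 0)) =
        fun z => c * S.indicator (fun _ => 1) z := by
      ext z; by_cases hz : z ∈ S <;> simp [hz]
    refine ⟨c • E.toFun S, ?_, ?_⟩
    · rw [e]; exact (hasIntegral_indicator hS).const_smul c
    · rw [e, mul_smul_comm]
      have := (hE.hasIntegral_mul_indicator h hφ hS).const_smul c
      simpa only [mul_left_comm] using this
  | add hd hf hg =>
    rename_i f g
    obtain ⟨A, hA, hA'⟩ := hf
    obtain ⟨B, hB, hB'⟩ := hg
    refine ⟨A + B, hA.add hB (fun x => f.integrable_of_isFiniteMeasure)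
      (fun x => g.integrable_of_isFiniteMeasure), ?_⟩
    have hi : ∀ (f : SimpleFunc X ℂ) x, Integrable (fun z => φ z * f z) (E.scalarMeasure x) :=
      fun f x => f.integrable_of_isFiniteMeasure.bdd_mul hφm.aestronglyMeasurable
        (Eventually.of_forall hR)
    rw [mul_add]
    simpa only [SimpleFunc.coe_add, Pi.add_apply, mul_add] using hA'.add hB' (hi f) (hi g)

/-- Integration against a projection-valued measure is multiplicative. -/
theorem IsProjectionValued.hasIntegral_mul (hE : E.IsProjectionValued)
    (h : E.HasIntegral φ T) (h' : E.HasIntegral χ T') (hφm : Measurable φ) (hχm : Measurable χ)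
    {R R' : ℝ} (hR : ∀ z, ‖φ z‖ ≤ R) (hR' : ∀ z, ‖χ z‖ ≤ R') :
    E.HasIntegral (fun z => φ z * χ z) (T * T') := by
  -- On an empty space the bounds `R` and `R'` may be negative, but then the identity operator is
  -- zero.
  rcases isEmpty_or_nonempty X with hX | ⟨⟨z₀⟩⟩
  · have h0 : (1 : H →L[ℂ] H) = 0 := by
      refine hasIntegral_one.unique (E := E) ?_
      convert hasIntegral_zero using 1
    rw [show T * T' = 0 by rw [← mul_one (T * T'), h0, mul_zero]]
    convert hasIntegral_zero using 1
  have hR0 : 0 ≤ R := (norm_nonneg _).trans (hR z₀)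
  have hR0' : 0 ≤ R' := (norm_nonneg _).trans (hR' z₀)
  have hs : StronglyMeasurable χ := hχm.stronglyMeasurable
  choose A hA hA' using fun n =>
    hE.exists_hasIntegral_mul_simpleFunc h hφm hR (hs.approxBounded R' n)
  have hdiag : ∀ x, Tendsto (fun n => ⟪A n x, x⟫_ℂ) atTop (𝓝 ⟪T' x, x⟫_ℂ) := by
    intro x
    have : Tendsto (fun n => ⟪x, A n x⟫_ℂ) atTop (𝓝 ⟪x, T' x⟫_ℂ) := by
      simp only [hA _ x, h' x]
      exact tendsto_integral_of_dominated_convergence (fun _ => R')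
        (fun n => (SimpleFunc.stronglyMeasurable _).aestronglyMeasurable) (integrable_const R')
        (fun n => Eventually.of_forall fun z => hs.norm_approxBounded_le hR0' n z)
        (Eventually.of_forall fun z => hs.tendsto_approxBounded_of_norm_le (hR' z))
    simpa only [Function.comp_def, inner_conj_symm] using
      (Complex.continuous_conj.tendsto _).comp this
  -- Dominated convergence only sees diagonal elements. Polarization upgrades it to weak operator
  -- convergence, which survives left multiplication by `T`.
  have hweak : ∀ x y, Tendsto (fun n => ⟪A n y, x⟫_ℂ) atTop (𝓝 ⟪T' y, x⟫_ℂ) := by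
    intro x y
    have e := fun B : H →L[ℂ] H => inner_map_polarization (B : H →ₗ[ℂ] H) x y
    simp only [ContinuousLinearMap.coe_coe] at e
    simp only [e]
    exact ((((hdiag _).sub (hdiag _)).add ((hdiag _).const_mul _)).sub
      ((hdiag _).const_mul _)).div_const 4
  intro x
  have hl : Tendsto (fun n => ⟪x, (T * A n) x⟫_ℂ) atTop (𝓝 ⟪x, (T * T') x⟫_ℂ) := by
    have := (Complex.continuous_conj.tendsto _).comp
      (hweak (ContinuousLinearMap.adjoint T x) x)
    simpa only [Function.comp_def, inner_conj_symm, ContinuousLinearMap.adjoint_inner_left]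
      using! this
  refine tendsto_nhds_unique hl ?_
  simp only [hA' _ x]
  refine tendsto_integral_of_dominated_convergence (fun _ => R * R')
    (fun n => (hφm.stronglyMeasurable.mul
      (SimpleFunc.stronglyMeasurable _)).aestronglyMeasurable) (integrable_const _)
    (fun n => Eventually.of_forall fun z => ?_)
    (Eventually.of_forall fun z => (hs.tendsto_approxBounded_of_norm_le (hR' z)).const_mul _)
  rw [norm_mul]
  exact mul_le_mul (hR z) (hs.norm_approxBounded_le hR0' n z) (norm_nonneg _) hR0

end ProjectionValued

end OperatorMeasure

/-! ### Moments of spectral measures and of their compressions -/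

theorem Circle.continuous_coe : Continuous (fun z : Circle => (z : ℂ)) := continuous_subtype_val

theorem Circle.measurable_coe : Measurable (fun z : Circle => (z : ℂ)) :=
  Circle.continuous_coe.measurable

theorem Circle.measurable_coe_zpow (l : ℤ) : Measurable (fun z : Circle => (z : ℂ) ^ l) := by
  have h : Continuous fun z : Circle => ((z ^ l : Circle) : ℂ) :=
    Circle.continuous_coe.comp (continuous_zpow l)
  simpa only [Circle.coe_zpow] using h.measurable

theorem Circle.norm_coe_zpow (z : Circle) (l : ℤ) : ‖(z : ℂ) ^ l‖ = 1 := by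
  rw [norm_zpow, Circle.norm_coe, one_zpow]

theorem IsSpectralMeasureOf.hasIntegral_pow {H : Type*} [NormedAddCommGroup H]
    [InnerProductSpace ℂ H] [CompleteSpace H] {E : OperatorMeasure Circle H} {U : H →L[ℂ] H}
    (h : IsSpectralMeasureOf E U) (n : ℕ) :
    E.HasIntegral (fun z : Circle => (z : ℂ) ^ n) (U ^ n) := by
  induction n with
  | zero => simpa using OperatorMeasure.hasIntegral_one
  | succ n ih =>
    have h1 : E.HasIntegral (fun z : Circle => (z : ℂ)) U := by
      rw [← h.2]
      exact E.hasIntegral_integral Circle.measurable_coe (R := 1) fun z => (Circle.norm_coe z).le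
    simp only [pow_succ]
    exact h.1.hasIntegral_mul ih h1 (Circle.measurable_coe.pow_const n) Circle.measurable_coe
      (R := 1) (R' := 1) (fun z => by rw [norm_pow, Circle.norm_coe, one_pow])
      (fun z => (Circle.norm_coe z).le)

namespace UnitaryExtension

variable {H : Type*} [NormedAddCommGroup H] [InnerProductSpace ℂ H] [CompleteSpace H]
  {K : H →L[ℂ] H} {H' : Type*} [NormedAddCommGroup H'] [InnerProductSpace ℂ H'] [CompleteSpace H']
  (K' : UnitaryExtension K H') {E : OperatorMeasure Circle H'}

omit [CompleteSpace H] in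
theorem pow_apply (n : ℕ) (x : H) : (K'.U ^ n) (K'.ι x) = K'.ι ((K ^ n) x) := by
  induction n generalizing x with
  | zero => rfl
  | succ n ih =>
    rw [pow_succ, pow_succ, mul_apply_eq_comp, mul_apply_eq_comp, K'.extends_op, ih]

/-- The embedding `ι` intertwines `K ^ n` with `U ^ n`, and `ι* ι = 1`; hence compressing `U ^ n`
returns `K ^ n`. -/
theorem hasIntegral_pow (hE : IsSpectralMeasureOf E K'.U) (n : ℕ) :
    (E.compression K'.ι).HasIntegral (fun z : Circle => (z : ℂ) ^ (n : ℤ)) (K ^ n) := by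
  have h := (hE.hasIntegral_pow n).compression K'.ι
  have e : K ^ n = ContinuousLinearMap.adjoint K'.ι.toContinuousLinearMap ∘L (K'.U ^ n) ∘L
      K'.ι.toContinuousLinearMap := by
    ext x
    refine ext_inner_left ℂ fun y => ?_
    simp [ContinuousLinearMap.adjoint_inner_right, K'.pow_apply]
  simp only [zpow_natCast]
  rw [e]
  exact h

/-- On the circle `z ^ (-n)` is the conjugate of `z ^ n`. Negative moments are thus powers of the
adjoint, even where `K` is not invertible. -/
theorem hasIntegral_adjoint_pow (hE : IsSpectralMeasureOf E K'.U) (n : ℕ) :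
    (E.compression K'.ι).HasIntegral (fun z : Circle => (z : ℂ) ^ (-(n : ℤ)))
      (ContinuousLinearMap.adjoint K ^ n) := by
  convert (K'.hasIntegral_pow hE n).adjoint using 1
  · ext z
    rw [map_zpow₀, ← Complex.inv_eq_conj (Circle.norm_coe z), inv_zpow, zpow_neg]
  · rw [← ContinuousLinearMap.star_eq_adjoint, ← ContinuousLinearMap.star_eq_adjoint, star_pow]

end UnitaryExtension

/-! ### Spectral calculus of the mpEDMD matrix -/

namespace MpEDMD

variable {N : ℕ} {G A : Matrix (Fin N) (Fin N) ℂ} (D : MpEDMD G A)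

theorem isUnit_det_sqrt (hG : G.PosDef) : IsUnit (CFC.sqrt G).det := by
  have h := congrArg Matrix.det (CFC.sqrt_mul_sqrt_self G hG.posSemidef.nonneg)
  rw [Matrix.det_mul] at h
  refine isUnit_of_mul_isUnit_left (y := (CFC.sqrt G).det) ?_
  rw [h]
  exact isUnit_iff_ne_zero.2 hG.det_pos.ne'

/-- The rank-one sum is `V φ(Λ) V* G`, and `V* G = Vhat* G^{1/2}`. In this form the calculus is
similar to a diagonal one. -/
theorem spectralIntegral_eq (hG : G.PosDef) (φ : Circle → ℂ) :
    D.spectralIntegral φ = (CFC.sqrt G)⁻¹ *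
      (D.Vhat * Matrix.diagonal (fun j => φ (D.eigenvalue j)) * D.Vhat.conjTranspose) *
        CFC.sqrt G := by
  set R := CFC.sqrt G with hR
  have hRR : R * R = G := CFC.sqrt_mul_sqrt_self G hG.posSemidef.nonneg
  have hRH : R.conjTranspose = R := (CFC.sqrt_nonneg G).isSelfAdjoint
  have hRi : R⁻¹ * R = 1 := Matrix.nonsing_inv_mul R (isUnit_det_sqrt hG)
  have h1 : D.spectralIntegral φ = (R⁻¹ * D.Vhat) *
      Matrix.diagonal (fun j => φ (D.eigenvalue j)) * (R⁻¹ * D.Vhat).conjTranspose * G := by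
    simp only [spectralIntegral, ← smul_mul_assoc, ← Finset.sum_mul]
    congr 1
    ext i k
    simp only [Matrix.sum_apply, Matrix.smul_apply, Matrix.vecMulVec_apply, smul_eq_mul,
      eigenvector, ← hR, Matrix.col_apply, Pi.star_apply]
    rw [Matrix.mul_apply]
    refine Finset.sum_congr rfl fun j _ => ?_
    rw [Matrix.mul_diagonal, Matrix.conjTranspose_apply]
    ring
  rw [h1, Matrix.conjTranspose_mul, Matrix.conjTranspose_nonsing_inv, hRH]
  have : R⁻¹ * G = R := by rw [← hRR, ← mul_assoc, hRi, one_mul]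
  simp only [mul_assoc, this]

theorem spectralIntegral_one (hG : G.PosDef) : D.spectralIntegral (fun _ => 1) = 1 := by
  rw [D.spectralIntegral_eq hG, Matrix.diagonal_one, mul_one, ← Matrix.star_eq_conjTranspose,
    Unitary.mul_star_self_of_mem D.Vhat_mem, mul_one,
    Matrix.nonsing_inv_mul _ (isUnit_det_sqrt hG)]

theorem spectralIntegral_mul (hG : G.PosDef) (φ χ : Circle → ℂ) :
    D.spectralIntegral φ * D.spectralIntegral χ = D.spectralIntegral fun z => φ z * χ z := by
  have hRi := Matrix.mul_nonsing_inv _ (isUnit_det_sqrt hG)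
  have hV : D.Vhat.conjTranspose * D.Vhat = 1 := Unitary.star_mul_self_of_mem D.Vhat_mem
  simp only [D.spectralIntegral_eq hG, ← Matrix.diagonal_mul_diagonal]
  simp only [mul_assoc]
  rw [← mul_assoc (CFC.sqrt G), hRi, one_mul, ← mul_assoc D.Vhat.conjTranspose, hV, one_mul]

theorem koopmanMatrix_eq (hG : G.PosDef) :
    D.koopmanMatrix = D.spectralIntegral (fun z => (z : ℂ)) := by
  rw [D.spectralIntegral_eq hG, koopmanMatrix, D.eigendecomposition]

theorem koopmanMatrix_pow (hG : G.PosDef) (n : ℕ) :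
    D.koopmanMatrix ^ n = D.spectralIntegral (fun z => (z : ℂ) ^ n) := by
  induction n with
  | zero => simp [D.spectralIntegral_one hG]
  | succ n ih => rw [pow_succ, ih, D.koopmanMatrix_eq hG, D.spectralIntegral_mul hG]; rfl

theorem koopmanMatrix_zpow (hG : G.PosDef) (l : ℤ) :
    D.koopmanMatrix ^ l = D.spectralIntegral (fun z => (z : ℂ) ^ l) := by
  obtain ⟨n, rfl | rfl⟩ := l.eq_nat_or_neg
  · simpa using D.koopmanMatrix_pow hG n
  · rw [Matrix.zpow_neg_natCast, D.koopmanMatrix_pow hG]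
    refine Matrix.inv_eq_right_inv ?_
    rw [D.spectralIntegral_mul hG]
    convert D.spectralIntegral_one hG using 2
    ext z
    rw [zpow_neg, zpow_natCast, mul_inv_cancel₀ (pow_ne_zero _ (Circle.coe_ne_zero z))]

theorem spectralIntegral_sub_sum (φ : Circle → ℂ) (s : Finset ℤ) (d : ℤ → ℂ)
    (χ : ℤ → Circle → ℂ) :
    D.spectralIntegral (fun z => φ z - ∑ l ∈ s, d l * χ l z) =
      D.spectralIntegral φ - ∑ l ∈ s, d l • D.spectralIntegral (χ l) := by
  simp only [spectralIntegral, sub_smul, Finset.sum_sub_distrib, Finset.sum_smul,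
    Finset.smul_sum, smul_smul]
  rw [Finset.sum_comm]

-- The factor between the two square roots is a diagonal matrix conjugated by a unitary, so its
-- operator norm is the largest `|φ|` at the eigenvalues. The outer factors are kept as they stand,
-- which avoids the condition number of `G^{1/2}`.
open scoped Matrix.Norms.L2Operator in
theorem norm_apply_spectralIntegral_le {W : Type*} [NormedAddCommGroup W] [NormedSpace ℂ W]
    (hG : G.PosDef) (Ψ : EuclideanSpace ℂ (Fin N) →L[ℂ] W) {φ : Circle → ℂ} {ε : ℝ}
    (hε : 0 ≤ ε) (hφ : ∀ z, ‖φ z‖ ≤ ε) (c : EuclideanSpace ℂ (Fin N)) :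
    ‖Ψ (Matrix.toEuclideanCLM (𝕜 := ℂ) (D.spectralIntegral φ) c)‖ ≤
      ε * (‖Ψ ∘L Matrix.toEuclideanCLM (𝕜 := ℂ) (CFC.sqrt G)⁻¹‖ *
        ‖Matrix.toEuclideanCLM (𝕜 := ℂ) (CFC.sqrt G) c‖) := by
  set B := D.Vhat * Matrix.diagonal (fun j => φ (D.eigenvalue j)) * D.Vhat.conjTranspose with hB
  have hBn : ‖Matrix.toEuclideanCLM (𝕜 := ℂ) B‖ ≤ ε := by
    rw [Matrix.l2_opNorm_toEuclideanCLM, hB, ← Matrix.star_eq_conjTranspose,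
      CStarRing.norm_mul_mem_unitary _ (Unitary.star_mem D.Vhat_mem),
      CStarRing.norm_mem_unitary_mul _ D.Vhat_mem, Matrix.l2_opNorm_diagonal]
    exact (pi_norm_le_iff_of_nonneg hε).2 fun j => hφ _
  rw [D.spectralIntegral_eq hG, map_mul, map_mul]
  set y := Matrix.toEuclideanCLM (𝕜 := ℂ) (CFC.sqrt G) c
  calc _ = ‖(Ψ ∘L Matrix.toEuclideanCLM (𝕜 := ℂ) (CFC.sqrt G)⁻¹)
        (Matrix.toEuclideanCLM (𝕜 := ℂ) B y)‖ := rfl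
    _ ≤ ‖Ψ ∘L Matrix.toEuclideanCLM (𝕜 := ℂ) (CFC.sqrt G)⁻¹‖ * (ε * ‖y‖) :=
        (ContinuousLinearMap.le_opNorm _ _).trans
          (mul_le_mul_of_nonneg_left (ContinuousLinearMap.le_of_opNorm_le _ hBn y)
            (norm_nonneg _))
    _ = _ := by ring

end MpEDMD

/-! ### Assembly of the error bound -/

theorem sum_Icc_neg_eq_add_sum {M : Type*} [AddCommMonoid M] (f : ℤ → M) (L : ℕ) :
    ∑ l ∈ Finset.Icc (-(L : ℤ)) L, f l = f 0 + ∑ l ∈ Finset.Icc 1 L, (f l + f (-(l : ℤ))) := by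
  induction L with
  | zero => simp
  | succ L ih =>
    have e : Finset.Icc (-((L + 1 : ℕ) : ℤ)) (L + 1 : ℕ) =
        insert ((L + 1 : ℕ) : ℤ) (insert (-((L + 1 : ℕ) : ℤ)) (Finset.Icc (-(L : ℤ)) L)) := by
      ext x; simp only [Finset.mem_Icc, Finset.mem_insert]; omega
    rw [e, Finset.sum_insert (by simp only [Finset.mem_Icc, Finset.mem_insert]; omega),
      Finset.sum_insert (by simp only [Finset.mem_Icc]; omega), ih,
      Finset.sum_Icc_succ_top (by omega)]
    abel

theorem four_pi_div_succ_le {L : ℕ} (hL : 2 ≤ L) :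
    4 * Real.pi / (L + 1 : ℕ) ≤ 4 * Real.pi / Real.log 2 * (Real.log L / L) := by
  have hL' : (2 : ℝ) ≤ L := by exact_mod_cast hL
  have h2 : 0 < Real.log 2 := Real.log_pos (by norm_num)
  have hlog : Real.log 2 ≤ Real.log L := Real.log_le_log (by norm_num) hL'
  have hpi := Real.pi_pos
  calc 4 * Real.pi / (L + 1 : ℕ) ≤ 4 * Real.pi / L := by gcongr; omega
    _ = 4 * Real.pi / Real.log 2 * (Real.log 2 / L) := by field_simp
    _ ≤ _ := by gcongr

/-- Comparison of the spectral calculus of a compressed unitary operator `K` with that of an mpEDMD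
matrix, through an arbitrary synthesis operator `Ψ`. -/
theorem norm_integral_sub_spectralIntegral_le {H : Type*} [NormedAddCommGroup H]
    [InnerProductSpace ℂ H] [CompleteSpace H] {K : H →L[ℂ] H} {H' : Type*}
    [NormedAddCommGroup H'] [InnerProductSpace ℂ H'] [CompleteSpace H']
    (K' : UnitaryExtension K H') {E' : OperatorMeasure Circle H'}
    (hE' : IsSpectralMeasureOf E' K'.U) {N : ℕ} {G A : Matrix (Fin N) (Fin N) ℂ}
    (hG : G.PosDef) (D : MpEDMD G A) (Ψ : EuclideanSpace ℂ (Fin N) →L[ℂ] H)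
    {φ : Circle → ℝ} (hφ : LipschitzWith 1 (fun θ : ℝ => φ (Circle.exp θ)))
    {L : ℕ} (hL : 2 ≤ L) (g : H) (c : EuclideanSpace ℂ (Fin N)) :
    ‖(E'.compression K'.ι).integral (fun z => (φ z : ℂ)) g -
        Ψ (Matrix.toEuclideanCLM (𝕜 := ℂ) (D.spectralIntegral (fun z => (φ z : ℂ))) c)‖ ≤
      8 * Real.pi / Real.log 2 * (Real.log L / L *
            (‖g‖ + ‖Ψ ∘L Matrix.toEuclideanCLM (𝕜 := ℂ) (CFC.sqrt G)⁻¹‖ *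
              ‖Matrix.toEuclideanCLM (𝕜 := ℂ) (CFC.sqrt G) c‖) +
          ‖g - Ψ c‖ * (⨆ z, |φ z|) +
          ∑ l ∈ Finset.Icc 1 L,
            (‖(K ^ l) g - Ψ (Matrix.toEuclideanCLM (𝕜 := ℂ) (D.koopmanMatrix ^ l) c)‖ +
              ‖((ContinuousLinearMap.adjoint K) ^ l) g -
                Ψ (Matrix.toEuclideanCLM (𝕜 := ℂ) (D.koopmanMatrix ^ (-(l : ℤ))) c)‖) / l) := by
  have hpi := Real.pi_gt_three
  have hlog2 : 0 < Real.log 2 := Real.log_pos (by norm_num)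
  have hlog2' : Real.log 2 ≤ 1 := by linarith [Real.log_two_lt_d9]
  -- The constant is dictated by the approximation term; it absorbs the coefficients `1` and `π / 2`
  -- of the other two.
  have hC : 8 * Real.pi ≤ 8 * Real.pi / Real.log 2 := by
    rw [le_div_iff₀ hlog2]; nlinarith
  set T := (E'.compression K'.ι).integral (fun z => (φ z : ℂ))
  set B := ‖Ψ ∘L Matrix.toEuclideanCLM (𝕜 := ℂ) (CFC.sqrt G)⁻¹‖ *
    ‖Matrix.toEuclideanCLM (𝕜 := ℂ) (CFC.sqrt G) c‖
  have hφc := continuous_of_lipschitzWith_exp hφ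
  have hbdd : BddAbove (Set.range fun z => |φ z|) :=
    (isCompact_range hφc.abs).bddAbove
  have hsup : ∀ z, |φ z| ≤ ⨆ z, |φ z| := fun z => le_ciSup hbdd z
  have hφm : Measurable fun z => (φ z : ℂ) := (Complex.continuous_ofReal.comp hφc).measurable
  have hφb : ∀ z, ‖(φ z : ℂ)‖ ≤ ⨆ z, |φ z| := fun z => by
    rw [Complex.norm_real]; exact hsup z
  -- With `n = L + 1` the polynomial has degree at most `n - 1 = L`, matching the powers in the sum.
  obtain ⟨d, hd, hd0, hdl⟩ := exists_trigonometric_approx hφ (n := L + 1) (by omega)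
  replace hd0 := hd0 _ hsup
  rw [show ((L + 1 : ℕ) : ℤ) - 1 = L by push_cast; ring] at hd
  have hε := four_pi_div_succ_le hL
  have hε0 : 0 ≤ 4 * Real.pi / (L + 1 : ℕ) := by positivity
  set ε := 4 * Real.pi / (L + 1 : ℕ)
  set s := Finset.Icc (-(L : ℤ)) L
  -- One integer-indexed family of moments; the two prescriptions agree at `0`.
  obtain ⟨Kz, hKz⟩ : ∃ Kz : ℤ → (H →L[ℂ] H), ∀ n : ℕ,
      Kz n = K ^ n ∧ Kz (-(n : ℤ)) = ContinuousLinearMap.adjoint K ^ n := by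
    refine ⟨fun l => if 0 ≤ l then K ^ l.toNat else ContinuousLinearMap.adjoint K ^ (-l).toNat,
      fun n => ⟨by simp, ?_⟩⟩
    rcases n.eq_zero_or_pos with rfl | hn
    · simp
    · simp only [if_neg (show ¬ 0 ≤ -(n : ℤ) by omega), neg_neg, Int.toNat_natCast]
  have hKint : ∀ l, (E'.compression K'.ι).HasIntegral (fun z : Circle => (z : ℂ) ^ l) (Kz l) := by
    intro l
    obtain ⟨n, rfl | rfl⟩ := l.eq_nat_or_neg
    · rw [(hKz n).1]; exact K'.hasIntegral_pow hE' n
    · rw [(hKz n).2]; exact K'.hasIntegral_adjoint_pow hE' n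
  have hzi : ∀ l y, Integrable (fun z : Circle => d l * (z : ℂ) ^ l)
      ((E'.compression K'.ι).scalarMeasure y) := fun l y =>
    (OperatorMeasure.integrable_of_norm_le (Circle.measurable_coe_zpow l)
      (fun z => (Circle.norm_coe_zpow z l).le) y).const_mul _
  have hTint : (E'.compression K'.ι).HasIntegral (fun z => (φ z : ℂ) - ∑ l ∈ s, d l * (z : ℂ) ^ l)
      (T - ∑ l ∈ s, d l • Kz l) :=
    (OperatorMeasure.hasIntegral_integral _ hφm hφb).sub
      (OperatorMeasure.HasIntegral.sum s (fun l _ => (hKint l).const_smul (d l))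
        fun l _ => hzi l)
      (OperatorMeasure.integrable_of_norm_le hφm hφb)
      fun y => integrable_finsetSum _ fun l _ => hzi l y
  have h1 : ‖(T - ∑ l ∈ s, d l • Kz l) g‖ ≤ 2 * ε * ‖g‖ :=
    ContinuousLinearMap.le_of_opNorm_le _ (hTint.norm_le hε0 hd) g
  have h2 := D.norm_apply_spectralIntegral_le hG Ψ hε0 hd c
  rw [D.spectralIntegral_sub_sum (fun z => (φ z : ℂ)) s d (fun l z => (z : ℂ) ^ l)] at h2
  simp only [← D.koopmanMatrix_zpow hG] at h2
  set v : ℤ → H := fun l =>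
    Kz l g - Ψ (Matrix.toEuclideanCLM (𝕜 := ℂ) (D.koopmanMatrix ^ l) c) with hv
  -- Adding and subtracting `q` on both sides leaves two approximation errors and the mismatch of
  -- moments weighted by `d`.
  have hdecomp : T g - Ψ (Matrix.toEuclideanCLM (𝕜 := ℂ)
      (D.spectralIntegral (fun z => (φ z : ℂ))) c) =
      (T - ∑ l ∈ s, d l • Kz l) g - Ψ (Matrix.toEuclideanCLM (𝕜 := ℂ)
        (D.spectralIntegral (fun z => (φ z : ℂ)) - ∑ l ∈ s, d l • D.koopmanMatrix ^ l) c) +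
      ∑ l ∈ s, d l • v l := by
    simp only [hv, map_sub, map_sum, map_smul, sub_apply, sum_apply, smul_apply, smul_sub,
      Finset.sum_sub_distrib]
    abel
  have h3 : ‖∑ l ∈ s, d l • v l‖ ≤ (⨆ z, |φ z|) * ‖g - Ψ c‖ +
      ∑ l ∈ Finset.Icc 1 L, Real.pi / 2 * ((‖v l‖ + ‖v (-(l : ℤ))‖) / l) := by
    rw [sum_Icc_neg_eq_add_sum]
    refine (norm_add_le _ _).trans (add_le_add ?_ (norm_sum_le_of_le _ fun l hl => ?_))
    · have : v 0 = g - Ψ c := by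
        have := (hKz 0).1
        simp only [Nat.cast_zero, pow_zero] at this
        simp [hv, this]
      rw [norm_smul, this]
      gcongr
    · obtain ⟨hl1, hlL⟩ := Finset.mem_Icc.1 hl
      have hl0 : (0 : ℝ) < l := by exact_mod_cast hl1
      have b1 := hdl l (by omega) (by rw [abs_of_nonneg] <;> omega)
      have b2 := hdl (-(l : ℤ)) (by omega) (by rw [abs_neg, abs_of_nonneg] <;> omega)
      simp only [Int.cast_neg, abs_neg, Int.cast_natCast, abs_of_pos hl0] at b1 b2
      calc ‖d l • v l + d (-(l : ℤ)) • v (-(l : ℤ))‖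
          ≤ Real.pi / (2 * l) * ‖v l‖ + Real.pi / (2 * l) * ‖v (-(l : ℤ))‖ := by
            refine (norm_add_le _ _).trans ?_
            rw [norm_smul, norm_smul]
            gcongr
        _ = _ := by field_simp
  rw [← Finset.mul_sum] at h3
  have hsum : ∑ l ∈ Finset.Icc 1 L, (‖v l‖ + ‖v (-(l : ℤ))‖) / l =
      ∑ l ∈ Finset.Icc 1 L,
        (‖(K ^ l) g - Ψ (Matrix.toEuclideanCLM (𝕜 := ℂ) (D.koopmanMatrix ^ l) c)‖ +
          ‖((ContinuousLinearMap.adjoint K) ^ l) g -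
            Ψ (Matrix.toEuclideanCLM (𝕜 := ℂ) (D.koopmanMatrix ^ (-(l : ℤ))) c)‖) / l := by
    refine Finset.sum_congr rfl fun l _ => ?_
    simp only [hv, (hKz l).1, (hKz l).2, zpow_natCast]
  rw [← hsum, hdecomp]
  have hQ : 0 ≤ ∑ l ∈ Finset.Icc 1 L, (‖v l‖ + ‖v (-(l : ℤ))‖) / (l : ℝ) :=
    Finset.sum_nonneg fun l _ => by positivity
  set Q := ∑ l ∈ Finset.Icc 1 L, (‖v l‖ + ‖v (-(l : ℤ))‖) / (l : ℝ)
  have hs0 : 0 ≤ ⨆ z, |φ z| := (abs_nonneg _).trans (hsup 1)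
  have hB0 : 0 ≤ B := by positivity
  calc _ ≤ 2 * ε * ‖g‖ + ε * B + ((⨆ z, |φ z|) * ‖g - Ψ c‖ + Real.pi / 2 * Q) :=
        (norm_add_le _ _).trans (add_le_add ((norm_sub_le _ _).trans (add_le_add h1 h2)) h3)
    _ ≤ 2 * ε * (‖g‖ + B) + (1 * (‖g - Ψ c‖ * (⨆ z, |φ z|)) + Real.pi / 2 * Q) := by
        nlinarith
    _ ≤ 2 * (4 * Real.pi / Real.log 2 * (Real.log L / L)) * (‖g‖ + B) +
          (8 * Real.pi / Real.log 2 * (‖g - Ψ c‖ * (⨆ z, |φ z|)) +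
            8 * Real.pi / Real.log 2 * Q) := by
        gcongr <;> linarith
    _ = _ := by ring

end

theorem theorem5p1 :
    ∃ C : ℝ, ∀ (Ω : Type*) [MeasurableSpace Ω] (ω : Measure Ω) (F : Ω → Ω)
      (hF : MeasurePreserving F ω ω)
      -- the spectral measure of the Koopman operator, through any unitary extension
      (H' : Type*) [NormedAddCommGroup H'] [InnerProductSpace ℂ H'] [CompleteSpace H']
      (K' : UnitaryExtension (koopman hF) H') (E' : OperatorMeasure Circle H')
      (_ : IsSpectralMeasureOf E' K'.U)
      -- the dictionary, the nodes, the quadrature weights, and the output of mpEDMD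
      (N M : ℕ) (ψ : Fin N → Ω → ℂ) (hψ : ∀ j, MemLp (ψ j) 2 ω) (x : Fin M → Ω) (w : Fin M → ℝ)
      (_ : (gramMatrix ψ x w).PosDef)
      (D : MpEDMD (gramMatrix ψ x w) (crossMatrix F ψ x w))
      -- a function on the circle that is 1-Lipschitz for arc length (in particular any function
      -- that is 1-Lipschitz for the distance of the complex plane)
      (φ : Circle → ℝ) (_ : LipschitzWith 1 (fun θ : ℝ => φ (Circle.exp θ)))
      (L : ℕ) (_ : 2 ≤ L) (g : Lp ℂ 2 ω) (c : EuclideanSpace ℂ (Fin N)),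
      ‖(E'.compression K'.ι).integral (fun z => (φ z : ℂ)) g -
          quasimatrix hψ (Matrix.toEuclideanCLM (𝕜 := ℂ)
            (D.spectralIntegral (fun z => (φ z : ℂ))) c)‖ ≤
        C * (Real.log L / L *
              (‖g‖ + ‖quasimatrix hψ ∘L
                  Matrix.toEuclideanCLM (𝕜 := ℂ) (CFC.sqrt (gramMatrix ψ x w))⁻¹‖ *
                ‖Matrix.toEuclideanCLM (𝕜 := ℂ) (CFC.sqrt (gramMatrix ψ x w)) c‖) +
            ‖g - quasimatrix hψ c‖ * (⨆ z, |φ z|) +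
            ∑ l ∈ Finset.Icc 1 L,
              (‖(koopman hF ^ l) g - quasimatrix hψ (Matrix.toEuclideanCLM (𝕜 := ℂ)
                  (D.koopmanMatrix ^ l) c)‖ +
                ‖((ContinuousLinearMap.adjoint (koopman hF)) ^ l) g -
                  quasimatrix hψ (Matrix.toEuclideanCLM (𝕜 := ℂ)
                    (D.koopmanMatrix ^ (-(l : ℤ))) c)‖) / l) := by
  refine ⟨8 * Real.pi / Real.log 2, ?_⟩
  intro Ω _ ω F hF H' _ _ _ K' E' hE' N M ψ hψ x w hG D φ hφ L hL g c
  exact norm_integral_sub_spectralIntegral_le K' hE' hG D (quasimatrix hψ) hφ hL g c
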